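/- For a field $K$ let $\Gamma_K=\mathrm{Gal}(K^{\mathrm{sep}}/K)$ be its absolute Galois group, with the Krull topology. For a finite group $G$ let $e(G)$ be its exponent, i.e. the least common multiple of the orders of its elements. Let $H$ be a finite group, $A$ an $H$-module and $F$ a field. A class $\alpha\in H^2(H,A)$ is called negligible over $F$ if, for every field extension $K/F$ and every continuous homomorphism $\rho\colon\Gamma_K\to H$, one has $\rho^*(\alpha)=0$ in $H^2(\Gamma_K,A)$; here $A$ is viewed as a discrete $\Gamma_K$-module through $\rho$, and $H^2(\Gamma_K,A)$ is continuous cohomology. The classes that are negligible over $F$ form a subgroup $H^2(H,A)_{\mathrm{neg},F}$ of $H^2(H,A)$. Theorem. Let $H$ be a finite group, let $A$ be a finite $H$-module, and let $F$ be a field containing a primitive root of unity of order $e(A)e(H)$. Then the subgroup $H^2(H,A)_{\mathrm{neg},F}$ of $H^2(H,A)$ is generated by the images of the maps \[ A^{H'}\otimes_{\mathbb Z} H^2(H',\mathbb Z)\xrightarrow{\ \cup\ } H^2(H',A)\xrightarrow{\ \mathrm{cor}\ } H^2(H,A), \] where $H'$ ranges over all subgroups of $H$; here $H'$ acts trivially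 on $\mathbb Z$, the first map is the cup product, and the second is the corestriction. In particular, this subgroup does not depend on $F$: if $F'$ is any other field containing a primitive root of unity of order $e(A)e(H)$, then $H^2(H,A)_{\mathrm{neg},F'}=H^2(H,A)_{\mathrm{neg},F}$. -/

import Mathlib

open CategoryTheory

universe u v w

noncomputable section

namespace NegligibleClasses

/-! ### Defining maps out of `H²(G, A)` by a formula on inhomogeneous `2`-cocycles -/

section Lift

variable {k G : Type u} [CommRing k] [Group G] {A : Rep.{u} k G}
  {M : Type w} [AddCommGroup M] [Module k M]

theorem surjective_H2π (A : Rep.{u} k G) :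
    Function.Surjective (groupCohomology.H2π A).hom := fun x =>
  groupCohomology.H2_induction_on (C := fun x => ∃ c, (groupCohomology.H2π A).hom c = x)
    x fun c => ⟨c, rfl⟩

/-- The linear map on `H²(G, A)` induced by a linear map on `2`-cocycles that kills the
`2`-coboundaries. -/
def liftH2 (f : groupCohomology.cocycles₂ A →ₗ[k] M)
    (hf : ∀ c : groupCohomology.cocycles₂ A, ⇑c ∈ groupCohomology.coboundaries₂ A → f c = 0) :
    groupCohomology.H2 A →ₗ[k] M :=
  (LinearMap.ker (groupCohomology.H2π A).hom).liftQ f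
      (fun c hc => hf c ((groupCohomology.H2π_eq_zero_iff c).1 hc)) ∘ₗ
    ((groupCohomology.H2π A).hom.quotKerEquivOfSurjective (surjective_H2π A)).symm.toLinearMap

theorem liftH2_H2π (f : groupCohomology.cocycles₂ A →ₗ[k] M)
    (hf : ∀ c : groupCohomology.cocycles₂ A, ⇑c ∈ groupCohomology.coboundaries₂ A → f c = 0)
    (c : groupCohomology.cocycles₂ A) :
    liftH2 f hf (groupCohomology.H2π A c) = f c := by
  have h : ((groupCohomology.H2π A).hom.quotKerEquivOfSurjective (surjective_H2π A)).symm
      ((groupCohomology.H2π A).hom c) = Submodule.Quotient.mk c := by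
    rw [LinearEquiv.symm_apply_eq]
    rfl
  exact (congrArg ((LinearMap.ker (groupCohomology.H2π A).hom).liftQ f
    fun c hc => hf c ((groupCohomology.H2π_eq_zero_iff c).1 hc)) h).trans rfl

end Lift

/-! ### Continuous cohomology in degree `2`, with discrete coefficients -/

section Continuous

variable {k : Type u} [CommRing k] {Γ : Type v} [Group Γ] [TopologicalSpace Γ] (M : Rep.{w} k Γ)

/-- The continuous inhomogeneous `2`-cocycles of the topological group `Γ` with values in the
discrete module `M`; a map to a discrete space is continuous iff it is locally constant. -/
def contCocycles₂ : Submodule k (Γ × Γ → M) where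
  carrier := {c | IsLocallyConstant c ∧
    ∀ g h j : Γ, c (g * h, j) + c (g, h) = M.ρ g (c (h, j)) + c (g, h * j)}
  zero_mem' := ⟨IsLocallyConstant.const 0, fun g h j => by simp⟩
  add_mem' := by
    rintro c d ⟨hc, hc'⟩ ⟨hd, hd'⟩
    refine ⟨hc.add hd, fun g h j => ?_⟩
    simp only [Pi.add_apply, map_add]
    rw [add_add_add_comm, hc', hd', add_add_add_comm]
  smul_mem' := by
    rintro n c ⟨hc, hc'⟩
    refine ⟨hc.comp (n • ·), fun g h j => ?_⟩
    simp only [Pi.smul_apply, map_smul]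
    rw [← smul_add, hc', smul_add]

/-- The coboundaries of continuous `1`-cochains, inside the continuous `2`-cocycles. -/
def contCoboundaries₂ : Submodule k (contCocycles₂ M) where
  carrier := {c | ∃ b : Γ → M, IsLocallyConstant b ∧
    ∀ g h : Γ, c.1 (g, h) = M.ρ g (b h) - b (g * h) + b g}
  zero_mem' := ⟨0, IsLocallyConstant.const 0, fun g h => by simp⟩
  add_mem' := by
    rintro c d ⟨b, hb, hb'⟩ ⟨b', hd, hd'⟩
    refine ⟨b + b', hb.add hd, fun g h => ?_⟩
    simp only [Submodule.coe_add, Pi.add_apply, map_add, hb', hd']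
    abel
  smul_mem' := by
    rintro n c ⟨b, hb, hb'⟩
    refine ⟨n • b, hb.comp (n • ·), fun g h => ?_⟩
    simp only [Submodule.coe_smul, Pi.smul_apply, map_smul, hb', smul_add, smul_sub]

/-- `H²(Γ, M)` for a topological (e.g. profinite) group `Γ` and a discrete `Γ`-module `M`. -/
abbrev ContH2 : Type (max v w) := contCocycles₂ M ⧸ contCoboundaries₂ M

end Continuous

/-! ### Pullback along a continuous homomorphism to a discrete group -/

section Pullback

variable {k H : Type u} [CommRing k] [Group H] (A : Rep.{u} k H) {Γ : Type v} [Group Γ] [TopologicalSpace Γ]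
  (ρ : Γ →* H) (hρ : IsLocallyConstant ρ)

/-- The pullback `c ↦ ((g, h) ↦ c (ρ g, ρ h))` of `2`-cocycles. -/
def pullbackCocycle : groupCohomology.cocycles₂ A →ₗ[k] contCocycles₂ (Rep.res ρ A) where
  toFun c := ⟨fun p => c (ρ p.1, ρ p.2),
    ((hρ.comp_continuous continuous_fst).prodMk (hρ.comp_continuous continuous_snd)).comp c,
    fun g h j => by
      have := (groupCohomology.mem_cocycles₂_iff (c : H × H → A)).1 c.2 (ρ g) (ρ h) (ρ j)
      simpa using! this⟩
  map_add' _ _ := rfl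
  map_smul' _ _ := rfl

/-- The map `ρ^* : H²(H, A) → H²(Γ, A)` induced by a continuous homomorphism `ρ : Γ → H` to the
discrete group `H`, where `Γ` acts on the discrete module `A` through `ρ`. -/
def pullback : groupCohomology.H2 A →ₗ[k] ContH2 (Rep.res ρ A) :=
  liftH2 ((contCoboundaries₂ (Rep.res ρ A)).mkQ ∘ₗ pullbackCocycle A ρ hρ) fun c hc => by
    obtain ⟨b, hb⟩ := hc
    refine (Submodule.Quotient.mk_eq_zero _).2 ⟨fun g => b (ρ g), hρ.comp b, fun g h => ?_⟩
    have := congrFun hb (ρ g, ρ h)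
    change c (ρ g, ρ h) = _
    rw [← this]
    simp [groupCohomology.d₁₂]

end Pullback

/-! ### Negligible classes -/

section Negligible

/-- The absolute Galois group `Γ_K = Gal(K^sep / K)`, with its Krull topology. -/
abbrev AbsGal (K : Type u) [Field K] : Type u := Gal(SeparableClosure K/K)

/-- `α ∈ H²(H, A)` is negligible over `F` if `ρ^* α = 0` in `H²(Γ_K, A)` for every field extension
`K / F` and every continuous homomorphism `ρ : Γ_K → H`. -/
def IsNegligible (F : Type u) [Field F] {H : Type} [Group H] (A : Rep.{0} ℤ H)
    (α : groupCohomology.H2 A) : Prop :=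
  ∀ (K : Type u) [Field K] [Algebra F K] (ρ : AbsGal K →* H) (hρ : IsLocallyConstant ρ),
    pullback A ρ hρ α = 0

/-- The subgroup of `H²(H, A)` formed by the classes that are negligible over `F`. -/
def negligibleSubgroup (F : Type u) [Field F] {H : Type} [Group H] (A : Rep.{0} ℤ H) :
    AddSubgroup (groupCohomology.H2 A) where
  carrier := {α | IsNegligible F A α}
  zero_mem' := fun K _ _ ρ hρ => map_zero _
  add_mem' := fun ha hb K _ _ ρ hρ => by rw [map_add, ha K ρ hρ, hb K ρ hρ, add_zero]
  neg_mem' := fun ha K _ _ ρ hρ => by rw [map_neg, ha K ρ hρ, neg_zero]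

end Negligible

/-! ### The cup product `A^G ⊗ H²(G, k) → H²(G, A)` -/

section Cup

variable {k G : Type u} [CommRing k] [Group G] (A : Rep.{u} k G)

/-- The cup product of the `0`-cocycle `a ∈ A^G` with a `2`-cocycle `c` with values in `k`: the
cochain `(g, h) ↦ a ⊗ c (g, h)`, where `A ⊗ k` is identified with `A`. -/
def cupCocycle (a : A.ρ.invariants) :
    groupCohomology.cocycles₂ (Rep.trivial k G k) →ₗ[k] groupCohomology.cocycles₂ A where
  toFun c := ⟨fun p => (show k from c p) • (a : A), by
    rw [groupCohomology.mem_cocycles₂_iff]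
    intro g h j
    have hc := (groupCohomology.mem_cocycles₂_iff (c : G × G → Rep.trivial k G k)).1 c.2 g h j
    have hc' : (show k from c (g * h, j)) + (show k from c (g, h)) =
        (show k from c (h, j)) + (show k from c (g, h * j)) := by simpa using! hc
    rw [map_smul, a.2 g, ← add_smul, ← add_smul, hc']⟩
  map_add' c d := Subtype.ext (funext fun p => add_smul (R := k) _ _ _)
  map_smul' n c := Subtype.ext (funext fun p => mul_smul (α := k) n _ _)

/-- The cup product with a fixed `a ∈ A^G` on cohomology classes. -/
def cupLeft (a : A.ρ.invariants) :
    groupCohomology.H2 (Rep.trivial k G k) →ₗ[k] groupCohomology.H2 A :=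
  liftH2 ((groupCohomology.H2π A).hom ∘ₗ cupCocycle A a) fun c hc => by
    refine (groupCohomology.H2π_eq_zero_iff _).2 ?_
    obtain ⟨b, hb⟩ := hc
    refine ⟨fun g => (show k from b g) • (a : A), funext fun p => ?_⟩
    have h := congrFun hb p
    have h' : (show k from b p.2) - (show k from b (p.1 * p.2)) + (show k from b p.1) =
        (show k from c p) := by simpa [groupCohomology.d₁₂] using! h
    change A.ρ p.1 ((show k from b p.2) • (a : A)) - (show k from b (p.1 * p.2)) • (a : A) +
      (show k from b p.1) • (a : A) = (show k from c p) • (a : A)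
    rw [map_smul, a.2 p.1, ← sub_smul, ← add_smul, h']

theorem cupLeft_H2π (a : A.ρ.invariants)
    (c : groupCohomology.cocycles₂ (Rep.trivial k G k)) :
    cupLeft A a (groupCohomology.H2π _ c) = groupCohomology.H2π A (cupCocycle A a c) :=
  liftH2_H2π _ _ c

/-- The cup product `A^G ⊗ H²(G, k) → H²(G, A)`. -/
def cup : TensorProduct k A.ρ.invariants (groupCohomology.H2 (Rep.trivial k G k)) →ₗ[k]
    groupCohomology.H2 A :=
  TensorProduct.lift <| LinearMap.mk₂ k (fun a x => cupLeft A a x)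
    (fun a a' x => by
      obtain ⟨c, rfl⟩ := surjective_H2π _ x
      refine (cupLeft_H2π A _ c).trans ?_
      refine Eq.trans ?_ (congrArg₂ (· + ·) (cupLeft_H2π A a c) (cupLeft_H2π A a' c)).symm
      rw [← map_add]
      exact congrArg _ (Subtype.ext (funext fun p => smul_add (M := k) _ _ _)))
    (fun n a x => by
      obtain ⟨c, rfl⟩ := surjective_H2π _ x
      refine (cupLeft_H2π A _ c).trans ?_
      refine Eq.trans ?_ (congrArg (n • ·) (cupLeft_H2π A a c)).symm
      rw [← map_smul]
      exact congrArg _ (Subtype.ext (funext fun p => smul_comm (M := k) (N := k) _ n _)))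
    (fun a x y => map_add _ x y)
    (fun n a x => map_smul _ n x)

end Cup

/-! ### Corestriction in degree `2` -/

section Cores

variable {k G : Type u} [CommRing k] [Group G] (S : Subgroup G)

/-- For the section `q ↦ q.out` of `G → G ⧸ S`, the element `q.out⁻¹ * g * (g⁻¹ • q).out` of `S`. -/
def transv (q : G ⧸ S) (g : G) : S :=
  ⟨q.out⁻¹ * g * (g⁻¹ • q).out, by
    rw [mul_assoc, ← QuotientGroup.eq, QuotientGroup.out_eq', ← smul_eq_mul,
      MulAction.Quotient.coe_smul_out, smul_inv_smul]⟩

theorem transv_mul (q : G ⧸ S) (g h : G) :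
    transv S q (g * h) = transv S q g * transv S (g⁻¹ • q) h := by
  apply Subtype.ext
  simp only [transv, Subgroup.coe_mul, mul_inv_rev, mul_smul]
  group

theorem mul_out (q : G ⧸ S) (g : G) : g * (g⁻¹ • q).out = q.out * transv S q g := by
  simp only [transv]
  group

variable [S.FiniteIndex] (A : Rep.{u} k G)

attribute [local instance] Subgroup.fintypeQuotientOfFiniteIndex

/-- The corestriction of a `1`-cochain. -/
def coresCochain₁ (b : S → A) (g : G) : A := ∑ q : G ⧸ S, A.ρ q.out (b (transv S q g))

/-- The corestriction of a `2`-cochain: the sum over the cosets `q = sS`, with representatives `s`,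
of `s • c (s⁻¹ g s', s'⁻¹ h s'')`, where `s'` and `s''` are the representatives of `g⁻¹ s S` and of
`(g h)⁻¹ s S`. On homogeneous cochains this is the norm from `S` to `G`. -/
def coresCochain₂ (c : S × S → A) (p : G × G) : A :=
  ∑ q : G ⧸ S, A.ρ q.out (c (transv S q p.1, transv S (p.1⁻¹ • q) p.2))

/-- Reindexing the sum over the cosets by the action of `g`. -/
theorem ρ_sum_out (f : G ⧸ S → A) (g : G) :
    A.ρ g (∑ q : G ⧸ S, A.ρ q.out (f q)) =
      ∑ q : G ⧸ S, A.ρ q.out (A.ρ (transv S q g : G) (f (g⁻¹ • q))) := by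
  rw [map_sum, ← Equiv.sum_comp (MulAction.toPerm g⁻¹)]
  refine Finset.sum_congr rfl fun q _ => ?_
  rw [MulAction.toPerm_apply, ← Module.End.mul_apply, ← map_mul, mul_out, map_mul,
    Module.End.mul_apply]

/-- Corestriction of `2`-cocycles. -/
def coresCocycle :
    groupCohomology.cocycles₂ (Rep.res S.subtype A) →ₗ[k] groupCohomology.cocycles₂ A where
  toFun c := ⟨coresCochain₂ S A c, by
    rw [groupCohomology.mem_cocycles₂_iff]
    intro g h j
    simp only [coresCochain₂]
    rw [ρ_sum_out S A (fun q => c (transv S q h, transv S (h⁻¹ • q) j)) g,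
      ← Finset.sum_add_distrib, ← Finset.sum_add_distrib]
    refine Finset.sum_congr rfl fun q _ => ?_
    rw [← map_add (A.ρ q.out), ← map_add (A.ρ q.out), transv_mul, transv_mul, mul_inv_rev, mul_smul]
    exact congrArg (A.ρ q.out) ((groupCohomology.mem_cocycles₂_iff
      (c : S × S → Rep.res S.subtype A)).1 c.2 _ _ _)⟩
  map_add' c d := Subtype.ext <| funext fun p => by
    change coresCochain₂ S A (c + d) p = coresCochain₂ S A c p + coresCochain₂ S A d p
    simp only [coresCochain₂]
    rw [← Finset.sum_add_distrib]
    exact Finset.sum_congr rfl fun q _ => map_add _ _ _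
  map_smul' n c := Subtype.ext <| funext fun p => by
    change coresCochain₂ S A (n • c) p = n • coresCochain₂ S A c p
    simp only [coresCochain₂]
    rw [Finset.smul_sum]
    exact Finset.sum_congr rfl fun q _ => map_smul _ _ _

/-- The corestriction `cor : H²(S, A) → H²(G, A)`, for a subgroup `S` of finite index in `G`. -/
def cores : groupCohomology.H2 (Rep.res S.subtype A) →ₗ[k] groupCohomology.H2 A :=
  liftH2 ((groupCohomology.H2π A).hom ∘ₗ coresCocycle S A) fun c hc => by
    refine (groupCohomology.H2π_eq_zero_iff _).2 ?_
    obtain ⟨b, hb⟩ := hc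
    refine ⟨coresCochain₁ S A b, funext fun p => ?_⟩
    change A.ρ p.1 (coresCochain₁ S A b p.2) - coresCochain₁ S A b (p.1 * p.2) +
      coresCochain₁ S A b p.1 = coresCochain₂ S A c p
    simp only [coresCochain₁, coresCochain₂]
    rw [ρ_sum_out S A (fun q => b (transv S q p.2)) p.1, ← Finset.sum_sub_distrib,
      ← Finset.sum_add_distrib]
    refine Finset.sum_congr rfl fun q _ => ?_
    rw [← map_sub, ← map_add, transv_mul, ← hb]
    rfl

end Cores

/-! ### The subgroup generated by corestrictions of cup products -/

section Generated

/-- The composite `A^{H'} ⊗ H²(H', k) → H²(H', A) → H²(H, A)` of the cup product and the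
corestriction, for a subgroup `H'` of `H`. -/
def corCup {k H : Type u} [CommRing k] [Group H] [Finite H] (A : Rep.{u} k H) (H' : Subgroup H) :
    TensorProduct k (Rep.res H'.subtype A).ρ.invariants
      (groupCohomology.H2 (Rep.trivial k H' k)) →ₗ[k] groupCohomology.H2 A :=
  cores H' A ∘ₗ cup (Rep.res H'.subtype A)

/-- The subgroup of `H²(H, A)` generated by the images of the maps
`A^{H'} ⊗ H²(H', ℤ) → H²(H', A) → H²(H, A)`, over all subgroups `H'` of `H`. -/
def corCupSubgroup {H : Type} [Group H] [Finite H] (A : Rep.{0} ℤ H) :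
    AddSubgroup (groupCohomology.H2 A) :=
  ⨆ H' : Subgroup H, (corCup A H').toAddMonoidHom.range

end Generated

end NegligibleClasses

end

/-!
Write `n` for the exponent of `A`, `m` for that of `H`, and let `ξ` be a primitive `nm`-th root of
unity; `ω = ξ ^ n` and `ζ = ξ ^ m` are primitive of orders `m` and `n`.

**Corestrictions of cup products are negligible.** A class in `H²(H', ℤ)` is the Bockstein of a
character of `H'`: a cocycle `c` satisfies `m c = dX` for some `X : H' → ℤ`
(`exists_primitive_of_exponent_dvd`). On an open subgroup of `Γ_K` that maps to `H'`, the
character `ω ^ X` has the form `u ↦ u y / y` by Hilbert's Theorem 90, and an `n`-th root of `y`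
lifts it to a character with values in the `nm`-th roots of unity; so the Bockstein becomes
divisible by `n` and is killed by the cup product with an element of `A`. To avoid a double coset
formula, this is done simultaneously over all points of the `Γ_K`-set `H ⧸ H'`: the cochain
defining the corestriction only involves the cocycle `transv` on the action groupoid, for which
Hilbert's Theorem 90 holds (`exists_transv_eigenvector`), and comparing `X` with the exponents of
the Galois action on `n`-th roots gives an explicit primitive (`exists_radical_primitive`).

**Negligible classes are sums of such corestrictions.** Negligibility is only used for one field
extension: `K = L^H`, where `L = k(x_h : h ∈ H)`, `k` is an algebraic closure of `F` and `H`
permutes the variables. Since `k[x_h : h ∈ H]` is factorial and `kˣ` is divisible, `Lˣ` modulo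
`d`-th powers is free on the irreducible polynomials up to units, which `H` permutes up to
constants that are powers of `ω` (`PermutationBasis`, `nonempty_permutationBasis`). If a cocycle
`c` becomes the coboundary of `b` on `Γ_K`, then `b` restricts on `Γ_L` to an `H`-equivariant
homomorphism `φ : Γ_L → A`, up to a constant. By Kummer theory `φ = ∑ t_p ⊗ α_p`, where `t_p` is
the Kummer character of `p` (`exists_eq_sum_kummer`), with unique coefficients
(`eq_zero_of_sum_kummer_eq_zero`); hence `α_p` is fixed by the stabilizer of `p`. The cochain `∑_p
τ_p α_p`, where `τ_p` extends `t_p` to `Γ_K` by the exponents of the Galois action on the `n`-th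
roots of the `p`, agrees with `φ` on `Γ_L`, and by the computation of the first part its
coboundary is inflated from a sum of corestrictions of `α_p ∪ δχ_p`, with `χ_p` the character by
which the stabilizer of `p` acts on `p`. The difference of `b` and this cochain descends to `H`
(`H2π_mem_corCupSubgroup_of_permutationBasis`).
-/

noncomputable section

namespace NegligibleClasses

/-! ### Hilbert's Theorem 90 for characters of open subgroups -/

section Kummer

variable {K S : Type*} [Field K] [Field S] [Algebra K S]

theorem isLocallyConstant_apply [Algebra.IsIntegral K S] (x : S) :
    IsLocallyConstant fun g : Gal(S/K) => g x := by
  have := IntermediateField.adjoin.finiteDimensional (Algebra.IsIntegral.isIntegral (R := K) x)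
  have ho := (IntermediateField.adjoin K {x}).fixingSubgroup_isOpen
  refine (IsLocallyConstant.iff_exists_open _).2 fun g =>
    ⟨_, ho.smul g, ⟨1, one_mem _, mul_one g⟩, ?_⟩
  rintro _ ⟨h, hh, rfl⟩
  have : h x = x := hh ⟨x, IntermediateField.mem_adjoin_simple_self K x⟩
  change g (h x) = g x
  rw [this]

/-- Hilbert's Theorem 90 for a character of an open subgroup of the Galois group with values in
the ground field. -/
theorem exists_eigenvector [IsGalois K S] (U : Subgroup Gal(S/K)) (hU : IsOpen (U : Set Gal(S/K)))
    (χ : U →* Kˣ) (hχ : IsLocallyConstant χ) :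
    ∃ y : S, y ≠ 0 ∧ ∀ u : U, (u : Gal(S/K)) y = algebraMap K S (χ u) * y := by
  classical
  set V : Subgroup Gal(S/K) := χ.ker.map U.subtype
  have hV : IsOpen (V : Set Gal(S/K)) := by
    have h1 : IsOpen (χ.ker : Set U) := hχ.isOpen_fiber 1
    exact hU.isOpenMap_subtype_val _ h1
  have hVc : IsClosed (V : Set Gal(S/K)) := V.isClosed_of_isOpen hV
  have hUc : IsClosed (U : Set Gal(S/K)) := U.isClosed_of_isOpen hU
  have : CompactSpace U := isCompact_iff_compactSpace.1 hUc.isCompact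
  have : Finite χ.range := (hχ.range_finite).to_subtype
  have : Finite (U ⧸ χ.ker) := Finite.of_equiv _
    (QuotientGroup.quotientKerEquivRange χ).symm.toEquiv
  have := Fintype.ofFinite (U ⧸ χ.ker)
  let M := IntermediateField.fixedField V
  have hM : M.fixingSubgroup = V := InfiniteGalois.fixingSubgroup_fixedField ⟨V, hVc⟩
  -- the embeddings of the fixed field of `ker χ` given by the cosets of `ker χ`
  let f : U ⧸ χ.ker → (M →* S) := fun q =>
    (((q.out : Gal(S/K)) : S →ₐ[K] S) : S →* S).comp (M.val : M →* S)
  have hf : ∀ q x, f q x = (q.out : Gal(S/K)) (x : S) := fun _ _ => rfl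
  have hfeq : ∀ u : U, ∀ x : M, (u : Gal(S/K)) (x : S) = f (u : U ⧸ χ.ker) x := by
    intro u x
    rw [hf]
    obtain ⟨v, hv⟩ := QuotientGroup.mk_out_eq_mul χ.ker u
    rw [hv]
    have : ((v : U) : Gal(S/K)) (x : S) = x := x.2 ⟨(v : U), ⟨v, v.2, rfl⟩⟩
    change _ = (u : Gal(S/K)) (((v : U) : Gal(S/K)) (x : S))
    rw [this]
  have hinj : Function.Injective f := by
    intro q q' h
    rw [← q.out_eq', ← q'.out_eq', QuotientGroup.eq]
    have : ((q.out⁻¹ * q'.out : U) : Gal(S/K)) ∈ M.fixingSubgroup := by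
      intro x
      have h1 := DFunLike.congr_fun h x
      rw [hf, hf] at h1
      change (q.out : Gal(S/K))⁻¹ ((q'.out : Gal(S/K)) (x : S)) = x
      rw [← h1]
      exact (q.out : Gal(S/K)).symm_apply_apply _
    rw [hM] at this
    obtain ⟨v, hv, hv'⟩ := this
    rwa [← Subtype.ext hv']
  have hli := (linearIndependent_monoidHom M S).comp f hinj
  rw [Fintype.linearIndependent_iff] at hli
  have hχq : ∀ u : U, χ ((u : U ⧸ χ.ker).out) = χ u := fun u => by
    obtain ⟨v, hv⟩ := QuotientGroup.mk_out_eq_mul χ.ker u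
    rw [hv, map_mul, v.2, mul_one]
  obtain ⟨x, hx⟩ : ∃ x : M, ∑ q, algebraMap K S ((χ q.out)⁻¹ : Kˣ) * f q x ≠ 0 := by
    by_contra! h
    have := hli (fun q => algebraMap K S ((χ q.out)⁻¹ : Kˣ))
      (funext fun x => by simpa using h x) ((1 : U) : U ⧸ χ.ker)
    simp at this
  -- the twisted trace of `x` is an eigenvector
  refine ⟨_, hx, fun u => ?_⟩
  rw [map_sum, Finset.mul_sum, ← Equiv.sum_comp (MulAction.toPerm u : Equiv.Perm (U ⧸ χ.ker))
    (fun q => algebraMap K S (χ u) * (algebraMap K S ((χ q.out)⁻¹ : Kˣ) * f q x))]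
  refine Finset.sum_congr rfl fun q _ => ?_
  have hq : (u • q : U ⧸ χ.ker) = ((u * q.out : U) : U ⧸ χ.ker) := by
    conv_lhs => rw [← q.out_eq']
    rfl
  rw [MulAction.toPerm_apply, hq, hχq, ← hfeq, map_mul, AlgEquiv.commutes, ← mul_assoc, ← map_mul,
    hf]
  congr 2
  simp only [mul_inv_rev, map_mul, Units.val_mul]
  rw [mul_comm, mul_assoc, ← Units.val_mul, inv_mul_cancel, Units.val_one, mul_one]

end Kummer

/-! ### Hilbert's Theorem 90 on the action groupoid of `H ⧸ H'` -/

section Groupoid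

variable {K S : Type*} [Field K] [Field S] [Algebra K S] {H : Type*} [Group H]

theorem transv_mul_of_smul_eq (H' : Subgroup H) (q : H ⧸ H') (g h : H) (hq : h⁻¹ • q = q) :
    transv H' q (h * g) = transv H' q h * transv H' q g := by
  rw [transv_mul, hq]

/-- Hilbert's Theorem 90 for the étale algebra attached to the `Gal(S/K)`-set `H ⧸ H'`: the cocycle
`(q, g) ↦ χ (transv q (ρ g))` on the action groupoid is a coboundary. -/
theorem exists_transv_eigenvector [IsGalois K S] (ρ : Gal(S/K) →* H) (hρ : IsLocallyConstant ρ)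
    (H' : Subgroup H) (χ : H' →* Kˣ) :
    ∃ y : H ⧸ H' → S, (∀ q, y q ≠ 0) ∧ ∀ q g,
      y q = algebraMap K S (χ (transv H' q (ρ g))) * g (y ((ρ g)⁻¹ • q)) := by
  -- a representative `r q` of the orbit of `q` and an element moving `r q` to `q`
  let r : H ⧸ H' → H ⧸ H' := fun q => (⟦q⟧ : MulAction.orbitRel.Quotient ρ.range (H ⧸ H')).out
  have hr : ∀ q g, r (ρ g • q) = r q := fun q g =>
    congrArg Quotient.out (Quotient.sound (s := MulAction.orbitRel ρ.range (H ⧸ H'))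
      ⟨⟨ρ g, g, rfl⟩, rfl⟩)
  have hγ : ∀ q, ∃ g, ρ g • r q = q := fun q => by
    obtain ⟨⟨_, g, rfl⟩, hg⟩ := Quotient.exact (s := MulAction.orbitRel ρ.range (H ⧸ H'))
      (Quotient.out_eq (⟦q⟧ : MulAction.orbitRel.Quotient ρ.range (H ⧸ H')))
    refine ⟨g⁻¹, ?_⟩
    rw [map_inv, inv_smul_eq_iff]
    exact hg.symm
  choose γ hγ using hγ
  let U : H ⧸ H' → Subgroup Gal(S/K) := fun q => (MulAction.stabilizer H q).comap ρ
  have hU : ∀ q, IsOpen (U q : Set Gal(S/K)) := fun q =>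
    hρ (MulAction.stabilizer H q : Set H)
  have hfix : ∀ q, ∀ u ∈ U q, (ρ u)⁻¹ • q = q := fun q u hu => inv_smul_eq_iff.2 (Eq.symm hu)
  let ψ : ∀ q, U q →* Kˣ := fun q =>
    { toFun := fun u => (χ (transv H' q (ρ u)))⁻¹
      map_one' := by
        have : transv H' q 1 = 1 := Subtype.ext (by simp [transv])
        simp [this]
      map_mul' := fun u v => by
        rw [Subgroup.coe_mul, map_mul, transv_mul_of_smul_eq H' q _ _ (hfix q u u.2), map_mul,
          mul_inv] }
  have hψ : ∀ q, IsLocallyConstant (ψ q) := fun q =>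
    (hρ.comp_continuous continuous_subtype_val).comp fun h => (χ (transv H' q h))⁻¹
  choose x hx0 hx using fun q => exists_eigenvector (U q) (hU q) (ψ q) (hψ q)
  refine ⟨fun q => algebraMap K S (χ (transv H' q (ρ (γ q)))) * γ q (x (r q)), fun q => ?_,
    fun q g => ?_⟩
  · exact mul_ne_zero (by simp) (by simpa using hx0 _)
  set q' := (ρ g)⁻¹ • q with hq'
  have hrq : r q' = r q := by rw [hq', ← map_inv, hr]
  set w := γ q' with hw
  have hw' : ρ w • r q = q' := by rw [← hrq]; exact hγ q'
  -- `γ q` and `g * γ q'` differ by an element of the stabilizer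
  obtain ⟨u, hu⟩ : ∃ u, g * w = γ q * u := ⟨(γ q)⁻¹ * (g * w), by group⟩
  have hu' : u ∈ U (r q) := by
    change ρ u • r q = r q
    have : u = (γ q)⁻¹ * (g * w) := by rw [hu]; group
    rw [this, map_mul, map_mul, mul_smul, mul_smul, hw', hq', smul_inv_smul, map_inv,
      inv_smul_eq_iff, hγ]
  have h1 := hx (r q) ⟨u, hu'⟩
  change u (x (r q)) = algebraMap K S ((χ (transv H' (r q) (ρ u)))⁻¹ : Kˣ) * x (r q) at h1
  change algebraMap K S (χ (transv H' q (ρ (γ q)))) * γ q (x (r q)) =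
    algebraMap K S (χ (transv H' q (ρ g))) *
      g (algebraMap K S (χ (transv H' q' (ρ w))) * w (x (r q')))
  rw [hrq, map_mul, AlgEquiv.commutes, ← mul_assoc, ← map_mul, ← Units.val_mul, ← map_mul,
    ← transv_mul, ← map_mul, ← AlgEquiv.mul_apply g w, hu, AlgEquiv.mul_apply, h1,
    map_mul ρ, map_mul (γ q), AlgEquiv.commutes, ← mul_assoc, ← map_mul, ← Units.val_mul,
    transv_mul, inv_smul_eq_iff.2 (hγ q).symm, map_mul χ, mul_assoc (χ _), mul_inv_cancel,
    mul_one]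

end Groupoid

/-! ### Pullbacks and corestricted cup products on cocycles -/

section Cohomology

variable {k H : Type u} [CommRing k] [Group H] (A : Rep.{u} k H)

/-- The class of `c` is killed by `ρ^*` iff the inflation of `c` is the coboundary of a continuous
cochain. -/
theorem pullback_H2π_eq_zero_iff {Γ : Type v} [Group Γ] [TopologicalSpace Γ] (ρ : Γ →* H)
    (hρ : IsLocallyConstant ρ) (c : groupCohomology.cocycles₂ A) :
    pullback A ρ hρ (groupCohomology.H2π A c) = 0 ↔ ∃ b : Γ → A, IsLocallyConstant b ∧
      ∀ g h : Γ, c (ρ g, ρ h) = A.ρ (ρ g) (b h) - b (g * h) + b g := by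
  have h1 : pullback A ρ hρ (groupCohomology.H2π A c) =
    (contCoboundaries₂ (Rep.res ρ A)).mkQ (pullbackCocycle A ρ hρ c) := liftH2_H2π _ _ c
  rw [h1, Submodule.mkQ_apply, Submodule.Quotient.mk_eq_zero]
  rfl

variable [Finite H]
attribute [local instance] Subgroup.fintypeQuotientOfFiniteIndex

theorem corCup_tmul_H2π (H' : Subgroup H) (a : (Rep.res H'.subtype A).ρ.invariants)
    (c : groupCohomology.cocycles₂ (Rep.trivial k H' k)) :
    corCup A H' (a ⊗ₜ groupCohomology.H2π _ c) =
      groupCohomology.H2π A (coresCocycle H' A (cupCocycle (Rep.res H'.subtype A) a c)) := by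
  have h1 : cup (Rep.res H'.subtype A) (a ⊗ₜ groupCohomology.H2π _ c) =
      groupCohomology.H2π _ (cupCocycle (Rep.res H'.subtype A) a c) :=
    (TensorProduct.lift.tmul _ _).trans (cupLeft_H2π _ a c)
  have h2 : cores H' A (groupCohomology.H2π _ (cupCocycle (Rep.res H'.subtype A) a c)) =
      groupCohomology.H2π A (coresCocycle H' A (cupCocycle (Rep.res H'.subtype A) a c)) :=
    liftH2_H2π _ _ _
  exact (congrArg (cores H' A) h1).trans h2

/-- Membership of the image of `corCup` in a subgroup is checked on the explicit cocycles of pure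
tensors. Over `ℤ` the invariants of a restricted representation carry two `ℤ`-module structures that
instance resolution does not identify; this form, over a general ring, does not mention them. -/
theorem corCup_mem_of_forall (H' : Subgroup H) (B : AddSubgroup (groupCohomology.H2 A))
    (h : ∀ a : A, (∀ s : H', A.ρ s a = a) → ∀ c : H' × H' → k,
      (∀ r s t, c (r * s, t) + c (r, s) = c (s, t) + c (r, s * t)) →
      ∀ C : groupCohomology.cocycles₂ A, (∀ g h, C (g, h) = ∑ q : H ⧸ H', A.ρ q.out
        (c (transv H' q g, transv H' (g⁻¹ • q) h) • a)) → groupCohomology.H2π A C ∈ B)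
    (t) : corCup A H' t ∈ B := by
  induction t using TensorProduct.induction_on with
  | zero => rw [map_zero]; exact zero_mem _
  | tmul a x =>
    obtain ⟨c, rfl⟩ := surjective_H2π _ x
    refine (corCup_tmul_H2π A H' a c).symm ▸ h a a.2 c (fun r s t => ?_) _ fun _ _ => rfl
    simpa using! (groupCohomology.mem_cocycles₂_iff (c : H' × H' → Rep.trivial k H' k)).1 c.2 r s t
  | add s t hs ht => rw [map_add]; exact add_mem hs ht

/-- The explicit cocycle of the image of a pure tensor under `corCup`, for elements `a` given by
their invariance property rather than in the submodule of invariants. -/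
theorem exists_corCup_eq (H' : Subgroup H) (a : A) (ha : ∀ s : H', A.ρ s a = a) (c : H' × H' → k)
    (hc : ∀ r s t, c (r * s, t) + c (r, s) = c (s, t) + c (r, s * t)) :
    ∃ C : groupCohomology.cocycles₂ A, (∀ g h, C (g, h) = ∑ q : H ⧸ H', A.ρ q.out
        (c (transv H' q g, transv H' (g⁻¹ • q) h) • a)) ∧
      ∃ t, corCup A H' t = groupCohomology.H2π A C :=
  ⟨_, fun _ _ => rfl, _, corCup_tmul_H2π A H' ⟨a, ha⟩ ⟨c,
    (groupCohomology.mem_cocycles₂_iff (A := Rep.trivial k H' k) c).2 fun r s t => by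
      simpa using! hc r s t⟩⟩

/-- An integral `2`-cocycle of a finite group of exponent dividing `m` becomes a coboundary after
multiplication by `m`. -/
theorem exists_primitive_of_exponent_dvd {G : Type} [Group G] [Finite G] {m : ℕ}
    (hm : Monoid.exponent G ∣ m) (c : G × G → ℤ)
    (hc : ∀ g h j, c (g * h, j) + c (g, h) = c (h, j) + c (g, h * j)) :
    ∃ X : G → ℤ, ∀ g h, m * c (g, h) = X h - X (g * h) + X g := by
  have := Fintype.ofFinite G
  -- averaging gives a primitive of `|G| • c`, a homomorphism modulo `|G|`
  let f : G → ℤ := fun g => ∑ j, c (g, j)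
  have hf : ∀ g h, Fintype.card G * c (g, h) = f h - f (g * h) + f g := fun g h => by
    have h1 : ∑ j, c (g, h * j) = f g := Equiv.sum_comp (Equiv.mulLeft h) fun j => c (g, j)
    have h2 := Finset.sum_congr (s₁ := Finset.univ) rfl fun j _ => hc g h j
    simp only [Finset.sum_add_distrib, Finset.sum_const, Finset.card_univ, nsmul_eq_mul] at h2
    rw [h1] at h2
    simp only [f] at *
    linarith
  have hpow : ∀ (g : G) (k : ℕ), (Fintype.card G : ℤ) ∣ k * f g - f (g ^ k) := fun g k => by
    induction k with
    | zero =>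
      have := hf 1 1
      rw [mul_one, sub_self, zero_add] at this
      simp [← this]
    | succ k ih =>
      have h1 : (Fintype.card G : ℤ) ∣ f g - f (g ^ k * g) + f (g ^ k) := ⟨_, (hf _ _).symm⟩
      have h3 : ((k + 1 : ℕ) : ℤ) * f g - f (g ^ (k + 1)) =
          k * f g - f (g ^ k) + (f g - f (g ^ k * g) + f (g ^ k)) := by
        rw [pow_succ]; push_cast; ring
      exact h3 ▸ dvd_add ih h1
  have hdvd : ∀ g, (Fintype.card G : ℤ) ∣ m * f g := fun g => by
    have h1 := hpow g m
    have h2 := hpow g 0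
    obtain ⟨l, rfl⟩ := hm
    rw [pow_mul, Monoid.pow_exponent_eq_one, one_pow] at h1
    rw [pow_zero] at h2
    simpa using dvd_sub h1 h2
  choose X hX using hdvd
  refine ⟨X, fun g h => mul_left_cancel₀ (b := _)
    (Int.natCast_ne_zero.2 (Fintype.card_ne_zero (α := G))) ?_⟩
  have h1 : (Fintype.card G : ℤ) * (m * c (g, h)) = m * (Fintype.card G * c (g, h)) := by ring
  rw [h1, hf, mul_add, mul_sub, mul_add, mul_sub, hX, hX, hX]

end Cohomology

/-! ### Radicals and primitives modulo `n` -/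

section Radicals

theorem isLocallyConstant_pi_of_finite {X ι : Type*} {Y : ι → Type*} [TopologicalSpace X]
    [Finite ι] {f : ∀ i, X → Y i} (hf : ∀ i, IsLocallyConstant (f i)) :
    IsLocallyConstant fun x i => f i x := by
  rw [IsLocallyConstant.iff_eventually_eq]
  intro x
  have := Filter.eventually_all.2 fun i => (IsLocallyConstant.iff_eventually_eq (f i)).1 (hf i) x
  filter_upwards [this] with y hy using funext hy

variable {K S : Type*} [Field K] [Field S] [Algebra K S] {H : Type*} [Group H]

/-- Let `z q`, for `q : H ⧸ H'`, be a family whose `n`-th powers satisfy the cocycle relation for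
the character `ω ^ X` of `H'`, where `ω = ξ ^ n` has order `m`, and let `c = dX / m` be the
Bockstein of `X`. Comparing the Galois action on the `z q` with `ξ ^ X` writes the pullback of `c`
to the action groupoid as a coboundary modulo `n`. -/
theorem exists_radical_primitive [IsGalois K S] [Finite H] (ρ : Gal(S/K) →* H)
    (hρ : IsLocallyConstant ρ) (H' : Subgroup H) {n m : ℕ} (hm : 0 < m) {ξ : Kˣ}
    (hξ : IsPrimitiveRoot ξ (n * m)) (hnm : 0 < n * m)
    (X : H' → ℤ) (c : H' × H' → ℤ) (hX : ∀ s t, m * c (s, t) = X t - X (s * t) + X s)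
    (z : H ⧸ H' → S) (hz0 : ∀ q, z q ≠ 0)
    (hz : ∀ q g, z q ^ n = algebraMap K S ((ξ ^ n) ^ X (transv H' q (ρ g)) : Kˣ) *
      g (z ((ρ g)⁻¹ • q)) ^ n) :
    ∃ κ : H ⧸ H' → Gal(S/K) → ℤ, (∀ q, IsLocallyConstant (κ q)) ∧
      (∀ q g, z q = algebraMap K S (ξ ^ (X (transv H' q (ρ g)) - m * κ q g) : Kˣ) *
        g (z ((ρ g)⁻¹ • q))) ∧
      ∀ q g h, (n : ℤ) ∣ c (transv H' q (ρ g), transv H' ((ρ g)⁻¹ • q) (ρ h)) -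
        (κ ((ρ g)⁻¹ • q) h - κ q (g * h) + κ q g) := by
  have hω : IsPrimitiveRoot (ξ ^ n) m := hξ.pow hnm rfl
  have hξS : IsPrimitiveRoot (algebraMap K S ξ) (n * m) :=
    (IsPrimitiveRoot.coe_units_iff.2 hξ).map_of_injective (algebraMap K S).injective
  have hinj : ∀ i : ℤ, algebraMap K S ((ξ ^ i : Kˣ)) = 1 → ((n * m : ℕ) : ℤ) ∣ i := fun i hi => by
    rw [← hξ.zpow_eq_one_iff_dvd]
    rw [← map_one (algebraMap K S)] at hi
    exact Units.ext ((algebraMap K S).injective hi)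
  -- a logarithm to base `ξ` on the `nm`-th roots of unity of `S`
  have hlog : ∀ x : S, ∃ i : ℤ, x ^ (n * m) = 1 → algebraMap K S (ξ ^ i : Kˣ) = x := fun x => by
    by_cases hx : x ^ (n * m) = 1
    · have : NeZero (n * m) := ⟨hnm.ne'⟩
      obtain ⟨i, -, hi⟩ := hξS.eq_pow_of_pow_eq_one hx
      exact ⟨i, fun _ => by simpa using hi⟩
    · exact ⟨0, fun h => absurd h hx⟩
  choose ε hε using hlog
  let τ : H ⧸ H' → Gal(S/K) → ℤ := fun q g => ε (z q / g (z ((ρ g)⁻¹ • q)))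
  have hτloc : ∀ q, IsLocallyConstant (τ q) := fun q => by
    have h1 := hρ.prodMk (isLocallyConstant_pi_of_finite fun q' : H ⧸ H' =>
      isLocallyConstant_apply (K := K) (z q'))
    exact h1.comp fun x => ε (z q / x.2 (x.1⁻¹ • q))
  have hg0 : ∀ (g : Gal(S/K)) q, g (z q) ≠ 0 := fun g q => by simpa using hz0 q
  have hτ : ∀ q g, z q = algebraMap K S (ξ ^ τ q g : Kˣ) * g (z ((ρ g)⁻¹ • q)) := fun q g => by
    rw [hε, div_mul_cancel₀ _ (hg0 g _)]
    rw [pow_mul, div_pow, hz q g, mul_div_cancel_right₀ _ (pow_ne_zero _ (hg0 g _)), ← map_pow,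
      ← Units.val_pow_eq_pow_val, ← zpow_natCast, ← zpow_mul, mul_comm, zpow_mul, zpow_natCast,
      hω.pow_eq_one, one_zpow, Units.val_one, map_one]
  -- `τ` agrees with `X` modulo `m`, and is a cocycle modulo `nm`
  have hTτ : ∀ q g, (m : ℤ) ∣ X (transv H' q (ρ g)) - τ q g := fun q g => by
    rw [← hω.zpow_eq_one_iff_dvd, zpow_sub, mul_inv_eq_one]
    have h1 := hz q g
    conv_lhs at h1 => rw [hτ q g, mul_pow]
    have h2 := mul_right_cancel₀ (pow_ne_zero _ (hg0 g _)) h1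
    rw [← map_pow, ← Units.val_pow_eq_pow_val] at h2
    rw [← Units.ext ((algebraMap K S).injective h2), ← zpow_natCast, ← zpow_natCast, ← zpow_mul,
      ← zpow_mul, mul_comm]
  have hcoc : ∀ q g h, ((n * m : ℕ) : ℤ) ∣ τ ((ρ g)⁻¹ • q) h - τ q (g * h) + τ q g :=
    fun q g h => by
    apply hinj
    have h1 := hτ q (g * h)
    conv_lhs at h1 => rw [hτ q g, hτ ((ρ g)⁻¹ • q) h]
    rw [map_mul ρ, mul_inv_rev, mul_smul, map_mul g, AlgEquiv.commutes, ← mul_assoc,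
      AlgEquiv.mul_apply] at h1
    have h2 := mul_right_cancel₀ (by simpa using hg0 h _) h1
    rw [← map_mul, ← Units.val_mul] at h2
    have h3 := Units.ext ((algebraMap K S).injective h2)
    rw [zpow_add, zpow_sub, mul_right_comm, mul_comm (ξ ^ τ _ h), h3, mul_inv_cancel,
      Units.val_one, map_one]
  choose κ hκ using hTτ
  refine ⟨κ, fun q => ?_, fun q g => ?_, fun q g h => ?_⟩
  · have h1 : κ q = fun g => (X (transv H' q (ρ g)) - τ q g) / m := funext fun g => by
      rw [hκ, Int.mul_ediv_cancel_left _ (by exact_mod_cast hm.ne')]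
    rw [h1]
    exact (hρ.prodMk (hτloc q)).comp fun x => (X (transv H' q x.1) - x.2) / m
  · rw [← hκ, sub_sub_cancel]
    exact hτ q g
  · obtain ⟨l, hl⟩ := hcoc q g h
    have hX' := hX (transv H' q (ρ g)) (transv H' ((ρ g)⁻¹ • q) (ρ h))
    have h1 := hκ q g
    have h2 := hκ ((ρ g)⁻¹ • q) h
    have h3 := hκ q (g * h)
    rw [map_mul, transv_mul] at h3
    refine ⟨l, mul_left_cancel₀ (b := _) (Int.natCast_ne_zero.2 hm.ne') ?_⟩
    push_cast at hl
    linear_combination hX' + h1 + h2 - h3 + hl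

end Radicals

/-! ### Induced cochains -/

section Cochains

variable {H : Type} [Group H] [Finite H] (A : Rep.{0} ℤ H)
attribute [local instance] Subgroup.fintypeQuotientOfFiniteIndex

/-- The cochain `g ↦ ∑ q, q.out • (κ q g • a)`: the corestriction formula for `1`-cochains, applied
to the product of `a` with an integral cochain `κ` on the action groupoid of `H ⧸ H'`. -/
def inducedCochain {Γ : Type*} (H' : Subgroup H) (κ : H ⧸ H' → Γ → ℤ) (a : A) (g : Γ) : A :=
  ∑ q : H ⧸ H', A.ρ q.out (κ q g • a)

theorem isLocallyConstant_inducedCochain {Γ : Type*} [TopologicalSpace Γ] (H' : Subgroup H)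
    {κ : H ⧸ H' → Γ → ℤ} (hκ : ∀ q, IsLocallyConstant (κ q)) (a : A) :
    IsLocallyConstant (inducedCochain A H' κ a) :=
  (isLocallyConstant_pi_of_finite hκ).comp fun x => ∑ q : H ⧸ H', A.ρ q.out (x q • a)

/-- If `κ` is a primitive modulo `n` of the pullback of `c` to the action groupoid and `n • a = 0`,
then the cochain induced by `κ` and `a` is a primitive of the pullback of the corestriction of
`a ∪ c`. -/
theorem coboundary_inducedCochain {Γ : Type*} [Group Γ] (ρ : Γ →* H) (H' : Subgroup H)
    (κ : H ⧸ H' → Γ → ℤ) (c : H' × H' → ℤ) {n : ℕ} {a : A} (hn : n • a = 0)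
    (ha : ∀ s : H', A.ρ s a = a)
    (hκ : ∀ q g h, (n : ℤ) ∣ c (transv H' q (ρ g), transv H' ((ρ g)⁻¹ • q) (ρ h)) -
      (κ ((ρ g)⁻¹ • q) h - κ q (g * h) + κ q g)) (g h : Γ) :
    ∑ q : H ⧸ H', A.ρ q.out (c (transv H' q (ρ g), transv H' ((ρ g)⁻¹ • q) (ρ h)) • a) =
      A.ρ (ρ g) (inducedCochain A H' κ a h) - inducedCochain A H' κ a (g * h) +
        inducedCochain A H' κ a g := by
  simp only [inducedCochain]
  rw [ρ_sum_out H' A (fun q => κ q h • a) (ρ g), ← Finset.sum_sub_distrib,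
    ← Finset.sum_add_distrib]
  refine Finset.sum_congr rfl fun q _ => ?_
  rw [map_zsmul (A.ρ (transv H' q (ρ g))), ha, ← map_sub, ← map_add, ← sub_smul, ← add_smul]
  congr 1
  obtain ⟨l, hl⟩ := hκ q g h
  rw [← sub_eq_zero, ← sub_smul, hl, mul_comm, mul_smul, natCast_zsmul, hn, smul_zero]

end Cochains

/-! ### Corestrictions of cup products are negligible -/

section CorCupNegligible

variable {H : Type} [Group H] [Finite H] (A : Rep.{0} ℤ H)
attribute [local instance] Subgroup.fintypeQuotientOfFiniteIndex

/-- `corCupSubgroup A` is generated by the classes of the explicit cocycles attached to `a` and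
`c`, written with the multiplication by integers of the abelian group `A`. -/
theorem corCupSubgroup_le (B : AddSubgroup (groupCohomology.H2 A))
    (h : ∀ (H' : Subgroup H) (a : A), (∀ s : H', A.ρ s a = a) → ∀ c : H' × H' → ℤ,
      (∀ r s t, c (r * s, t) + c (r, s) = c (s, t) + c (r, s * t)) →
      ∀ C : groupCohomology.cocycles₂ A, (∀ g h, C (g, h) = ∑ q : H ⧸ H', A.ρ q.out
        (c (transv H' q g, transv H' (g⁻¹ • q) h) • a)) → groupCohomology.H2π A C ∈ B) :
    corCupSubgroup A ≤ B := by
  refine iSup_le fun H' => ?_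
  rintro _ ⟨t, rfl⟩
  exact corCup_mem_of_forall A H' B (fun a ha c hc C hC => h H' a ha c hc C fun g h =>
    (hC g h).trans <| Finset.sum_congr rfl fun q _ => congrArg (A.ρ q.out)
      (int_smul_eq_zsmul _ _ _)) t

theorem exists_mem_corCupSubgroup (H' : Subgroup H) (a : A) (ha : ∀ s : H', A.ρ s a = a)
    (c : H' × H' → ℤ) (hc : ∀ r s t, c (r * s, t) + c (r, s) = c (s, t) + c (r, s * t)) :
    ∃ C : groupCohomology.cocycles₂ A, (∀ g h, C (g, h) = ∑ q : H ⧸ H', A.ρ q.out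
        (c (transv H' q g, transv H' (g⁻¹ • q) h) • a)) ∧
      groupCohomology.H2π A C ∈ corCupSubgroup A := by
  obtain ⟨C, hC, t, ht⟩ := exists_corCup_eq A H' a ha c hc
  refine ⟨C, fun g h => (hC g h).trans <| Finset.sum_congr rfl fun q _ => congrArg (A.ρ q.out)
      (int_smul_eq_zsmul _ _ _), ?_⟩
  exact ht ▸ AddSubgroup.mem_iSup_of_mem (S := fun H' => (corCup A H').toAddMonoidHom.range) H'
    ⟨t, rfl⟩

/-- The character `ω ^ X` of `H'` attached to an integral cocycle is, on the action groupoid of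
`H ⧸ H'`, the Kummer character of a family `y`; `n`-th roots of `y` give a primitive modulo `n`. -/
theorem corCupSubgroup_le_negligibleSubgroup [Finite A] (F : Type u) [Field F]
    (hF : ∃ ζ : F, IsPrimitiveRoot ζ (AddMonoid.exponent A * Monoid.exponent H)) :
    corCupSubgroup A ≤ negligibleSubgroup F A := by
  refine corCupSubgroup_le A _ fun H' a ha c hc C hC K _ _ ρ hρ => ?_
  obtain ⟨ζ, hζ⟩ := hF
  set n := AddMonoid.exponent A with hn
  set m := Monoid.exponent H with hm
  have hn0 : 0 < n := Nat.pos_of_ne_zero AddMonoid.exponent_ne_zero_of_finite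
  have hm0 : 0 < m := Nat.pos_of_ne_zero Monoid.exponent_ne_zero_of_finite
  have hnm : 0 < n * m := Nat.mul_pos hn0 hm0
  have hζK := hζ.map_of_injective (algebraMap F K).injective
  have : NeZero (n * m) := ⟨hnm.ne'⟩
  obtain ⟨ξ, hξ⟩ : ∃ ξ : Kˣ, IsPrimitiveRoot ξ (n * m) :=
    ⟨hζK.toRootsOfUnity, IsPrimitiveRoot.coe_units_iff.1 hζK⟩
  have hω : IsPrimitiveRoot (ξ ^ n) m := hξ.pow hnm rfl
  have hnK : NeZero (n : SeparableClosure K) := by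
    have h1 := hζK.neZero'
    rw [Nat.cast_mul] at h1
    refine ⟨fun h => h1.out ?_⟩
    rw [← map_natCast (algebraMap K _), map_eq_zero] at h
    rw [h, zero_mul]
  obtain ⟨X, hX⟩ := exists_primitive_of_exponent_dvd (m := m)
    (Monoid.exponent_dvd_of_monoidHom H'.subtype H'.subtype_injective) c hc
  let χ : H' →* Kˣ := MonoidHom.mk' (fun s => (ξ ^ n) ^ X s) fun s t => by
    have : X (s * t) = X s + X t - m * c (s, t) := by rw [hX]; ring
    rw [this, zpow_sub, zpow_add, zpow_mul, zpow_natCast, hω.pow_eq_one, one_zpow, inv_one, mul_one]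
  obtain ⟨y, hy0, hy⟩ := exists_transv_eigenvector ρ hρ H' χ
  choose z hz using fun q => IsSepClosed.exists_pow_nat_eq (y q) n
  obtain ⟨κ, hκ, -, hκ'⟩ := exists_radical_primitive ρ hρ H' hm0 hξ hnm X c hX z
    (fun q h => hy0 q (by rw [← hz, h, zero_pow hn0.ne'])) fun q g => by
      rw [← map_pow, hz, hz]; exact hy q g
  refine (pullback_H2π_eq_zero_iff A ρ hρ _).2
    ⟨inducedCochain A H' κ a, isLocallyConstant_inducedCochain A H' hκ _, fun g h => ?_⟩
  exact (hC _ _).trans <|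
    coboundary_inducedCochain A ρ H' κ c (AddMonoid.exponent_nsmul_eq_zero _) ha hκ' g h

end CorCupNegligible

/-! ### Coordinates on finite abelian groups -/

section Coordinates

/-- Coordinates on a finite abelian group with respect to a decomposition into cyclic groups. -/
theorem exists_zmod_coordinates (A : Type*) [AddCommGroup A] [Finite A] :
    ∃ (ι : Type) (_ : Fintype ι) (d : ι → ℕ) (ε : ι → A) (ψ : ∀ i, A →+ ZMod (d i)),
      (∀ i, d i ∣ AddMonoid.exponent A) ∧ (∀ i, d i • ε i = 0) ∧
        ∀ a, a = ∑ i, (ψ i a).val • ε i := by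
  classical
  obtain ⟨ι, hι, d, hd, ⟨E⟩⟩ := AddCommGroup.equiv_directSum_zmod_of_finite' A
  let of := fun i => (DirectSum.of (fun i => ZMod (d i)) i)
  let ε : ι → A := fun i => E.symm (of i 1)
  have hε : ∀ i (k : ℕ), k • ε i = E.symm (of i k) := fun i k => by
    rw [← map_nsmul E.symm, ← map_nsmul (of i), nsmul_one]
  refine ⟨ι, hι, d, ε, fun i => (DFinsupp.evalAddMonoidHom i).comp E.toAddMonoidHom, fun i => ?_,
    fun i => ?_, fun a => ?_⟩
  · have h1 := hε i (AddMonoid.exponent A)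
    rw [AddMonoid.exponent_nsmul_eq_zero] at h1
    have h2 := (map_eq_zero_iff _ E.symm.injective).1 h1.symm
    exact (ZMod.natCast_eq_zero_iff _ _).1
      ((map_eq_zero_iff _ (DirectSum.of_injective i)).1 h2)
  · rw [hε, ZMod.natCast_self, map_zero, map_zero]
  · apply E.injective
    have : ∀ i, NeZero (d i) := fun i => ⟨(zero_lt_one.trans (hd i)).ne'⟩
    simp only [hε, map_sum, AddEquiv.apply_symm_apply, ZMod.natCast_zmod_val]
    exact (DirectSum.sum_univ_of (E a)).symm

end Coordinates

/-! ### Kummer characters of a basis of `Lˣ` modulo powers -/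

section KummerBasis

variable {K S L H : Type*} [Field K] [Field S] [Algebra K S] [Field L] [Group H] {J : Type*}
  {n : ℕ} {ζ : Kˣ} (ρ : Gal(S/K) →* H) (ι : L →+* S) (P : J → L) (π : J → S)
  (t : J → Gal(S/K) → ℤ)

/-- Kummer theory: if `L` is the fixed field of `ker ρ` and `Lˣ` is generated by the `P j` modulo
`d`-th powers, then the Kummer characters of the `P j` generate the characters of `ker ρ` of order
dividing `d`. -/
theorem exists_kummer_coefficients [IsGalois K S] (hρ : IsLocallyConstant ρ)
    (hfix : ∀ x : S, (∀ g, ρ g = 1 → g x = x) → ∃ l, ι l = x)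
    (hι : ∀ g l, ρ g = 1 → g (ι l) = ι l)
    (hn : 0 < n) (hζ : IsPrimitiveRoot ζ n) (hP : ∀ j, P j ≠ 0) (hπ : ∀ j, π j ^ n = ι (P j))
    (ht : ∀ j g, ρ g = 1 → g (π j) = algebraMap K S (ζ ^ t j g : Kˣ) * π j)
    {d : ℕ} (hd : d ∣ n)
    (hgen : ∀ x : L, x ≠ 0 → ∃ y ≠ 0, ∃ e : J →₀ ℕ, x = y ^ d * e.prod fun j k => P j ^ k)
    (ψ : ρ.ker → ℤ) (hψ : IsLocallyConstant ψ)
    (hψmul : ∀ g h, (d : ℤ) ∣ ψ g + ψ h - ψ (g * h)) :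
    ∃ e : J →₀ ℕ, ∀ g : ρ.ker, (d : ℤ) ∣ ψ g - e.sum fun j k => k * t j g := by
  obtain ⟨l, rfl⟩ := hd
  have hd0 : 0 < d := Nat.pos_of_mul_pos_right hn
  have hζd : IsPrimitiveRoot (ζ ^ l) d := hζ.pow hn (mul_comm _ _)
  let χ : ρ.ker →* Kˣ := MonoidHom.mk' (fun g => (ζ ^ l) ^ ψ g) fun g h => by
    obtain ⟨k, hk⟩ := hψmul g h
    have : ψ (g * h) = ψ g + ψ h - d * k := by rw [← hk]; ring
    rw [this, zpow_sub, zpow_add, zpow_mul, zpow_natCast, hζd.pow_eq_one, one_zpow, inv_one,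
      mul_one]
  obtain ⟨z, hz0, hz⟩ := exists_eigenvector ρ.ker (hρ {1}) χ (hψ.comp fun k => (ζ ^ l) ^ k)
  have hz' : ∀ g : ρ.ker, (g : Gal(S/K)) z = algebraMap K S ((ζ ^ l) ^ ψ g : Kˣ) * z := hz
  obtain ⟨x, hx⟩ := hfix (z ^ d) fun g hg => by
    rw [map_pow, hz' ⟨g, hg⟩, mul_pow, ← map_pow, ← Units.val_pow_eq_pow_val, ← zpow_natCast,
      ← zpow_mul, mul_comm (ψ _), zpow_mul, zpow_natCast, hζd.pow_eq_one, one_zpow,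
      Units.val_one, map_one, one_mul]
  have hx0 : x ≠ 0 := by rintro rfl; exact pow_ne_zero d hz0 (by rw [← hx, map_zero])
  obtain ⟨y, hy0, e, rfl⟩ := hgen x hx0
  have hπ0 : ∀ j, π j ≠ 0 := fun j h => hP j <| by
    rw [← map_eq_zero ι, ← hπ, h, zero_pow hn.ne']
  -- `w` is a `d`-th root of `1`, hence lies in `K`
  set R := e.prod fun j k => (π j ^ l) ^ k with hR
  have hR0 : R ≠ 0 := Finsupp.prod_ne_zero_iff.2 fun j _ => pow_ne_zero _ (pow_ne_zero _ (hπ0 j))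
  have hzd : (z / (ι y * R)) ^ d = 1 := by
    have h1 : R ^ d = ι (e.prod fun j k => P j ^ k) := by
      rw [hR, Finsupp.prod, ← Finset.prod_pow, map_finsuppProd]
      refine Finset.prod_congr rfl fun j _ => ?_
      simp only
      rw [map_pow, ← hπ, ← pow_mul, ← pow_mul, ← pow_mul]
      congr 1; ring
    rw [div_pow, mul_pow, h1, ← hx, map_mul, map_pow, div_self]
    rw [← map_pow, ← map_mul]
    simpa using hx0
  have hζS : IsPrimitiveRoot (algebraMap K S (ζ ^ l : Kˣ)) d :=
    (IsPrimitiveRoot.coe_units_iff.2 hζd).map_of_injective (algebraMap K S).injective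
  have : NeZero d := ⟨hd0.ne'⟩
  obtain ⟨i, -, hi⟩ := hζS.eq_pow_of_pow_eq_one hzd
  rw [eq_div_iff (mul_ne_zero ((map_ne_zero ι).2 hy0) hR0)] at hi
  refine ⟨e, fun g => ?_⟩
  have hgR : (g : Gal(S/K)) R =
      algebraMap K S ((ζ ^ l) ^ (e.sum fun j k => (k : ℤ) * t j g) : Kˣ) * R := by
    rw [hR, map_finsuppProd, Finsupp.sum, Finsupp.prod, Finsupp.prod]
    have h1 : ((ζ ^ l) ^ (∑ j ∈ e.support, (e j : ℤ) * t j g) : Kˣ) =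
        ∏ j ∈ e.support, (ζ ^ l) ^ ((e j : ℤ) * t j g) :=
      map_sum (zmultiplesHom (Additive Kˣ) (Additive.ofMul (ζ ^ l))) _ _
    rw [h1, Units.coe_prod, map_prod, ← Finset.prod_mul_distrib]
    refine Finset.prod_congr rfl fun j _ => ?_
    rw [map_pow, map_pow, ht j g g.2, mul_pow, mul_pow, ← map_pow, ← map_pow,
      ← Units.val_pow_eq_pow_val, ← Units.val_pow_eq_pow_val]
    refine congrArg (fun u : Kˣ => algebraMap K S u * _) ?_
    rw [← zpow_natCast, ← zpow_natCast, ← zpow_natCast, ← zpow_mul, ← zpow_mul, ← zpow_mul]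
    congr 1; ring
  have h2 := hz' g
  rw [← hi, map_mul, map_mul, map_pow, AlgEquiv.commutes, hι g y g.2, hgR, mul_left_comm (ι y),
    mul_left_comm (_ ^ i)] at h2
  have h3 := mul_right_cancel₀ (mul_ne_zero (pow_ne_zero i
    ((map_ne_zero (algebraMap K S)).2 (Units.ne_zero (ζ ^ l))))
    (mul_ne_zero ((map_ne_zero ι).2 hy0) hR0)) h2
  have h4 := Units.ext ((algebraMap K S).injective h3)
  rw [← hζd.zpow_eq_one_iff_dvd, zpow_sub, h4, mul_inv_cancel]

variable {A : Type*} [AddCommGroup A] [Finite A]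

/-- The Kummer characters of a basis of `Lˣ` modulo `n`-th powers generate the continuous
homomorphisms from `ker ρ` to an abelian group of exponent `n`. -/
theorem exists_eq_sum_kummer [IsGalois K S]
    (hρ : IsLocallyConstant ρ)
    (hfix : ∀ x : S, (∀ g, ρ g = 1 → g x = x) → ∃ l, ι l = x)
    (hι : ∀ g l, ρ g = 1 → g (ι l) = ι l) (hA : AddMonoid.exponent A = n)
    (hn : 0 < n) (hζ : IsPrimitiveRoot ζ n) (hP : ∀ j, P j ≠ 0) (hπ : ∀ j, π j ^ n = ι (P j))
    (ht : ∀ j g, ρ g = 1 → g (π j) = algebraMap K S (ζ ^ t j g : Kˣ) * π j)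
    (hgen : ∀ d > 0, ∀ x : L, x ≠ 0 → ∃ y ≠ 0, ∃ e : J →₀ ℕ,
      x = y ^ d * e.prod fun j k => P j ^ k)
    (φ : ρ.ker → A) (hφ : IsLocallyConstant φ) (hφmul : ∀ g h, φ (g * h) = φ g + φ h) :
    ∃ α : J →₀ A, ∀ g : ρ.ker, φ g = α.sum fun j a => t j g • a := by
  obtain ⟨I, _, d, ε, ψ, hd, hε, hψ⟩ := exists_zmod_coordinates A
  rw [hA] at hd
  have hd0 : ∀ i, 0 < d i := fun i => Nat.pos_of_dvd_of_pos (hd i) hn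
  have : ∀ i, NeZero (d i) := fun i => ⟨(hd0 i).ne'⟩
  have h1 := fun i => exists_kummer_coefficients ρ ι P π t hρ hfix hι hn hζ hP hπ ht (hd i)
    (hgen _ (hd0 i)) (fun g => ((ψ i (φ g)).val : ℤ)) (hφ.comp fun a => ((ψ i a).val : ℤ))
    fun g h => by
      rw [← ZMod.intCast_zmod_eq_zero_iff_dvd]
      simp [hφmul]
  choose e he using h1
  refine ⟨∑ i, (e i).mapRange (fun k => k • ε i) (zero_smul _ _), fun g => ?_⟩
  rw [← Finsupp.sum_finsetSum_index (by simp) (by simp), hψ (φ g)]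
  refine Finset.sum_congr rfl fun i _ => ?_
  rw [Finsupp.sum_mapRange_index (by simp)]
  obtain ⟨r, hr⟩ := he i g
  rw [← natCast_zsmul, ← sub_add_cancel ((ψ i (φ g)).val : ℤ) ((e i).sum fun j k => k * t j g), hr,
    add_smul, mul_comm, mul_smul, natCast_zsmul, hε, smul_zero, zero_add, Finsupp.sum, Finsupp.sum,
    Finset.sum_smul]
  refine Finset.sum_congr rfl fun j _ => ?_
  rw [mul_comm, mul_smul, natCast_zsmul]

/-- The Kummer characters of elements of `Lˣ` that are independent modulo `n`-th powers are
independent, with coefficients in an abelian group of exponent `n`. -/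
theorem eq_zero_of_sum_kummer_eq_zero
    (hfix : ∀ x : S, (∀ g, ρ g = 1 → g x = x) → ∃ l, ι l = x)
    (hA : AddMonoid.exponent A = n)
    (hn : 0 < n) (hζ : IsPrimitiveRoot ζ n) (hπ : ∀ j, π j ^ n = ι (P j))
    (ht : ∀ j g, ρ g = 1 → g (π j) = algebraMap K S (ζ ^ t j g : Kˣ) * π j)
    (hind : ∀ (y : L) (e : J →₀ ℕ), (y ^ n = e.prod fun j k => P j ^ k) → ∀ j, n ∣ e j)
    (α : J →₀ A) (hα : ∀ g : ρ.ker, (α.sum fun j a => t j g • a) = 0) : α = 0 := by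
  obtain ⟨I, _, d, ε, ψ, hd, hε, hψ⟩ := exists_zmod_coordinates A
  rw [hA] at hd
  have hd0 : ∀ i, 0 < d i := fun i => Nat.pos_of_dvd_of_pos (hd i) hn
  have : ∀ i, NeZero (d i) := fun i => ⟨(hd0 i).ne'⟩
  -- if a coordinate of `α j` were nonzero, a product of the `π j` with exponents not all divisible
  -- by `n` would lie in `L`
  have key : ∀ i j, ψ i (α j) = 0 := fun i j => by
    obtain ⟨l, hl⟩ := hd i
    have hl0 : 0 < l := Nat.pos_of_ne_zero (by rintro rfl; simp [hl] at hn)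
    let e : J →₀ ℕ := α.mapRange (fun a => l * (ψ i a).val) (by simp)
    obtain ⟨y, hy⟩ := hfix (e.prod fun j k => π j ^ k) fun g hg => by
      rw [map_finsuppProd, Finsupp.prod, Finsupp.prod]
      have h1 : ∀ j, g (π j ^ e j) = algebraMap K S (ζ ^ ((e j : ℤ) * t j g) : Kˣ) * π j ^ e j :=
        fun j => by
        rw [map_pow, ht j g hg, mul_pow, ← map_pow, ← Units.val_pow_eq_pow_val, ← zpow_natCast,
          ← zpow_mul, mul_comm (t j g)]
      rw [Finset.prod_congr rfl fun j _ => h1 j, Finset.prod_mul_distrib, ← map_prod,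
        ← Units.coe_prod]
      have h2 : ∏ j ∈ e.support, ζ ^ ((e j : ℤ) * t j g) =
          (ζ ^ (∑ j ∈ e.support, (e j : ℤ) * t j g) : Kˣ) :=
        (map_sum (zmultiplesHom (Additive Kˣ) (Additive.ofMul ζ)) _ _).symm
      have h3 : (n : ℤ) ∣ ∑ j ∈ e.support, (e j : ℤ) * t j g := by
        have h4 : ∑ j ∈ e.support, (e j : ℤ) * t j g =
            l * ∑ j ∈ α.support, ((ψ i (α j)).val : ℤ) * t j g := by
          rw [Finset.mul_sum]
          refine (Finset.sum_subset (Finsupp.support_mapRange) fun j _ hj => ?_).trans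
            (Finset.sum_congr rfl fun j _ => ?_)
          · rw [Finsupp.notMem_support_iff.1 hj]; simp
          · simp [e, mul_assoc]
        rw [h4, hl, mul_comm (d i)]
        push_cast
        refine mul_dvd_mul_left _ ?_
        rw [← ZMod.intCast_zmod_eq_zero_iff_dvd]
        have h5 := congrArg (ψ i) (hα ⟨g, hg⟩)
        rw [Finsupp.sum, map_sum, map_zero] at h5
        push_cast
        rw [← h5]
        refine Finset.sum_congr rfl fun j _ => ?_
        rw [map_zsmul, zsmul_eq_mul, ZMod.natCast_zmod_val, mul_comm]
      rw [h2, (hζ.zpow_eq_one_iff_dvd _).2 h3, Units.val_one, map_one, one_mul]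
    have h6 := hind y e (ι.injective (by
      rw [map_pow, hy, Finsupp.prod, ← Finset.prod_pow, map_finsuppProd]
      refine Finset.prod_congr rfl fun j _ => ?_
      simp only
      rw [map_pow, ← hπ, ← pow_mul, ← pow_mul, mul_comm])) j
    have h7 : e j = l * (ψ i (α j)).val := by simp [e]
    rw [h7, hl, mul_comm (d i)] at h6
    have h8 := Nat.eq_zero_of_dvd_of_lt (Nat.dvd_of_mul_dvd_mul_left hl0 h6) (ZMod.val_lt _)
    exact (ZMod.val_eq_zero _).1 h8
  ext j
  rw [hψ (α j)]
  simp [key]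

end KummerBasis

/-! ### Permutation bases and descent of the primitive -/

section Core

/-- The structure of a permutation module, up to powers of a root of unity `ω` and modulo `d`-th
powers for every `d > 0`, on the multiplicative group of a field `L` with an action of `H`: the
elements `p i` represent the orbits, `stab i` is the stabilizer of `p i` up to powers of `ω`, and
the elements `q.out • p i`, for `q : H ⧸ stab i`, are a basis of `Lˣ` modulo `d`-th powers. The
integers `X i s` record the character by which `stab i` acts on `p i`. -/
structure PermutationBasis (H : Type v) (L : Type u) [Group H] [Field L] [MulSemiringAction H L]
    (ω : L) where
  Orbit : Type w
  stab : Orbit → Subgroup H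
  p : Orbit → L
  p_ne_zero : ∀ i, p i ≠ 0
  X : ∀ i, stab i → ℤ
  X_one : ∀ i, X i 1 = 0
  p_eq : ∀ i (s : stab i), p i = ω ^ X i s * (s : H) • p i
  exists_eq : ∀ d > 0, ∀ x : L, x ≠ 0 → ∃ y ≠ 0, ∃ e : (Σ i, H ⧸ stab i) →₀ ℕ,
    x = y ^ d * e.prod fun j k => (j.2.out • p j.1) ^ k
  dvd_of_pow_eq : ∀ d > 0, ∀ (y : L) (e : (Σ i, H ⧸ stab i) →₀ ℕ),
    (y ^ d = e.prod fun j k => (j.2.out • p j.1) ^ k) → ∀ j, d ∣ e j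

variable {K S : Type*} [Field K] [Field S] [Algebra K S]
attribute [local instance] Subgroup.fintypeQuotientOfFiniteIndex

theorem transv_one_right {H : Type*} [Group H] (H' : Subgroup H) (q : H ⧸ H') :
    transv H' q 1 = 1 := Subtype.ext (by simp [transv])

/-- If the inflation of `c` to `Gal(S/K)` is the coboundary of `b`, then up to a constant `b`
restricts to an equivariant homomorphism on `ker ρ`, which by Kummer theory is a combination of the
Kummer characters of a permutation basis. Its coefficients are invariant under the stabilizers,
and subtracting the cochains induced from them makes `b` descend to `H`. -/
theorem H2π_mem_corCupSubgroup_of_permutationBasis [IsGalois K S] [IsSepClosed S]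
    {H : Type} [Group H] [Finite H] (A : Rep.{0} ℤ H) [Finite A]
    {L : Type*} [Field L] [MulSemiringAction H L]
    (ρ : Gal(S/K) →* H) (hρ : IsLocallyConstant ρ) (hsurj : Function.Surjective ρ) (ι : L →+* S)
    (hι : ∀ g l, ι (ρ g • l) = g (ι l))
    (hfix : ∀ x : S, (∀ g, ρ g = 1 → g x = x) → ∃ l, ι l = x)
    {n m : ℕ} (hA : AddMonoid.exponent A = n) (hm : 0 < m)
    {ξ : Kˣ} (hξ : IsPrimitiveRoot ξ (n * m)) {ω : L}
    (hω : ι ω = algebraMap K S (ξ ^ n : Kˣ)) (B : PermutationBasis H L ω)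
    (c : groupCohomology.cocycles₂ A) (b : Gal(S/K) → A) (hb : IsLocallyConstant b)
    (hcb : ∀ g h, c (ρ g, ρ h) = A.ρ (ρ g) (b h) - b (g * h) + b g) :
    groupCohomology.H2π A c ∈ corCupSubgroup A := by
  classical
  have hn : 0 < n := hA ▸ Nat.pos_of_ne_zero AddMonoid.exponent_ne_zero_of_finite
  have hnm : 0 < n * m := Nat.mul_pos hn hm
  have hωK : IsPrimitiveRoot (ξ ^ n) m := hξ.pow hnm rfl
  have hζ : IsPrimitiveRoot (ξ ^ m) n := hξ.pow hnm (mul_comm _ _)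
  have hωL : IsPrimitiveRoot ω m := by
    refine IsPrimitiveRoot.of_map_of_injective (f := ι) ?_ ι.injective
    rw [hω]
    exact (IsPrimitiveRoot.coe_units_iff.2 hωK).map_of_injective (algebraMap K S).injective
  have hω0 : ω ≠ 0 := hωL.ne_zero hm.ne'
  have hωfix : ∀ h : H, h • ω = ω := fun h => by
    obtain ⟨g, rfl⟩ := hsurj h
    apply ι.injective
    rw [hι, hω, AlgEquiv.commutes]
  have hnS : NeZero (n : S) := by
    have : NeZero (n * m) := ⟨hnm.ne'⟩
    have h1 := (IsPrimitiveRoot.coe_units_iff.2 hξ).neZero'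
    rw [Nat.cast_mul] at h1
    refine ⟨fun h => h1.out ?_⟩
    rw [← map_natCast (algebraMap K _), map_eq_zero] at h
    rw [h, zero_mul]
  -- the Bockstein of the character of each stabilizer
  have hX : ∀ i (s t : B.stab i), (m : ℤ) ∣ B.X i t - B.X i (s * t) + B.X i s := fun i s t => by
    rw [← hωL.zpow_eq_one_iff_dvd, zpow_add₀ hω0, zpow_sub₀ hω0]
    have h1 := B.p_eq i s
    conv_rhs at h1 => rw [B.p_eq i t]
    rw [smul_mul', smul_zpow₀', hωfix, smul_smul, ← mul_assoc] at h1
    have h2 := h1.symm.trans (B.p_eq i (s * t))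
    have h3 : ((s : H) * t) • B.p i ≠ 0 := smul_ne_zero_iff_ne _ |>.2 (B.p_ne_zero i)
    have h4 := mul_right_cancel₀ h3 h2
    rw [← h4]
    have h5 := zpow_ne_zero (B.X i s) hω0
    have h6 := zpow_ne_zero (B.X i t) hω0
    field_simp
  choose β hβ using hX
  have hX' : ∀ i (s t : B.stab i),
      m * (fun x : B.stab i × B.stab i => β i x.1 x.2) (s, t) =
        B.X i t - B.X i (s * t) + B.X i s := fun i s t => (hβ i s t).symm
  have hm0 : (m : ℤ) ≠ 0 := by exact_mod_cast hm.ne'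
  have hβone : ∀ i s, β i s 1 = 0 := fun i s => by
    have := hβ i s 1
    rw [mul_one, B.X_one, zero_sub, neg_add_cancel, eq_comm, mul_eq_zero] at this
    exact this.resolve_left hm0
  have hone_β : ∀ i s, β i 1 s = 0 := fun i s => by
    have := hβ i 1 s
    rw [one_mul, B.X_one, sub_self, zero_add, eq_comm, mul_eq_zero] at this
    exact this.resolve_left hm0
  have hβcoc : ∀ i (r s t : B.stab i), β i (r * s) t + β i r s = β i s t + β i r (s * t) :=
    fun i r s t => by
    apply mul_left_cancel₀ hm0
    rw [mul_add, mul_add, ← hβ, ← hβ, ← hβ, ← hβ, mul_assoc]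
    ring
  -- radicals of the basis and their Kummer characters
  let P : (Σ i, H ⧸ B.stab i) → L := fun j => j.2.out • B.p j.1
  have hP0 : ∀ j, P j ≠ 0 := fun j => smul_ne_zero_iff_ne _ |>.2 (B.p_ne_zero j.1)
  choose π hπ using fun j => IsSepClosed.exists_pow_nat_eq (ι (P j)) n
  have hπ0 : ∀ j, π j ≠ 0 := fun j h => hP0 j <| by
    rw [← map_eq_zero ι, ← hπ, h, zero_pow hn.ne']
  have hrad : ∀ i (q : H ⧸ B.stab i) g, π ⟨i, q⟩ ^ n =
      algebraMap K S ((ξ ^ n) ^ B.X i (transv (B.stab i) q (ρ g)) : Kˣ) *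
        g (π ⟨i, (ρ g)⁻¹ • q⟩) ^ n := fun i q g => by
    have h1 : ∀ k : ℤ, algebraMap K S ((ξ ^ n) ^ k : Kˣ) = ι (ω ^ k) := fun k => by
      rw [map_zpow₀, hω, Units.val_zpow_eq_zpow_val, map_zpow₀]
    rw [← map_pow, hπ, hπ, ← hι, h1, ← map_mul, smul_smul, mul_out, mul_smul]
    have h2 := congrArg (q.out • ·) (B.p_eq i (transv (B.stab i) q (ρ g)))
    simp only [smul_mul', smul_zpow₀', hωfix] at h2
    exact congrArg ι h2
  choose κ hκ hκX hκcoc using fun i => exists_radical_primitive ρ hρ (B.stab i) hm hξ hnm (B.X i)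
    (fun x => β i x.1 x.2) (hX' i) (fun q => π ⟨i, q⟩) (fun q => hπ0 _) (hrad i)
  have ht : ∀ j g, ρ g = 1 → g (π j) = algebraMap K S ((ξ ^ m) ^ κ j.1 j.2 g : Kˣ) * π j :=
    fun j g hg => by
    have h1 := hκX j.1 j.2 g
    rw [hg, transv_one_right, B.X_one, zero_sub, inv_one, one_smul] at h1
    conv_rhs => rw [h1]
    rw [← mul_assoc, ← map_mul, ← Units.val_mul, zpow_neg, zpow_mul, zpow_natCast, mul_inv_cancel,
      Units.val_one, map_one, one_mul]
  -- the homomorphism on `ker ρ` given by `b`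
  let φ : ρ.ker → A := fun g => b g - c (1, 1)
  have hbone : ∀ g, ∀ u : ρ.ker, b (g * u) = b g + A.ρ (ρ g) (φ u) := fun g u => by
    have h1 := hcb g u
    rw [u.2, groupCohomology.cocycles₂_map_one_snd] at h1
    simp only [φ, map_sub]
    rw [h1]
    abel
  have honeb : ∀ g, ∀ u : ρ.ker, b (u * g) = b g + φ u := fun g u => by
    have h1 := hcb u g
    rw [u.2, groupCohomology.cocycles₂_map_one_fst, map_one] at h1
    simp only [φ]
    rw [h1]
    simp
  have hφmul : ∀ g h, φ (g * h) = φ g + φ h := fun g h => by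
    have h1 := honeb h g
    simp only [φ, Subgroup.coe_mul] at h1 ⊢
    rw [h1]
    abel
  have hφ : IsLocallyConstant φ :=
    (hb.comp_continuous continuous_subtype_val).comp fun x => x - c (1, 1)
  have hι' : ∀ g l, ρ g = 1 → g (ι l) = ι l := fun g l hg => by rw [← hι, hg, one_smul]
  obtain ⟨α, hα⟩ := exists_eq_sum_kummer ρ ι P π (fun j => κ j.1 j.2) hρ hfix hι' hA hn hζ hP0 hπ
    ht B.exists_eq φ hφ hφmul
  have hzn : ∀ {x y : ℤ} (a : A), (n : ℤ) ∣ x - y → x • a = y • a := fun {x y} a h => by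
    obtain ⟨r, hr⟩ := h
    rw [← sub_eq_zero, ← sub_smul, hr, mul_comm, mul_smul, natCast_zsmul, ← hA,
      AddMonoid.exponent_nsmul_eq_zero, smul_zero]
  -- equivariance of the coefficients
  have hαinv : ∀ (h : H) i q, α ⟨i, h • q⟩ = A.ρ h (α ⟨i, q⟩) := fun h i q => by
    obtain ⟨g, rfl⟩ := hsurj h
    let E : (Σ i, H ⧸ B.stab i) ≃ (Σ i, H ⧸ B.stab i) :=
      Equiv.sigmaCongrRight fun i => MulAction.toPerm (ρ g)
    let α' : (Σ i, H ⧸ B.stab i) →₀ A :=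
      (α.mapRange (A.ρ (ρ g)) (map_zero _)).equivMapDomain E
    have hα' : α - α' = 0 := by
      refine eq_zero_of_sum_kummer_eq_zero ρ ι P π (fun j => κ j.1 j.2) hfix hA hn hζ hπ ht
        (B.dvd_of_pow_eq n hn) _ fun u => ?_
      rw [Finsupp.sum_sub_index fun j a a' => smul_sub _ a a', sub_eq_zero, ← hα,
        Finsupp.sum_equivMapDomain, Finsupp.sum_mapRange_index (by simp)]
      let u' : ρ.ker := ⟨g⁻¹ * u * g, by
        have : ρ u = 1 := u.2
        rw [MonoidHom.mem_ker, map_mul, map_mul, this, mul_one, map_inv, inv_mul_cancel]⟩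
      have h1 : φ u = A.ρ (ρ g) (φ u') := by
        have h2 := hbone g u'
        have h3 : g * u' = u * g := by simp only [u']; group
        rw [h3, honeb] at h2
        exact add_left_cancel h2
      rw [h1, hα, Finsupp.sum, Finsupp.sum, map_sum]
      refine Finset.sum_congr rfl fun j _ => ?_
      rw [map_zsmul]
      refine hzn _ ?_
      change (n : ℤ) ∣ κ j.1 j.2 u' - κ j.1 (ρ g • j.2) u
      have h4 := hκcoc j.1 (ρ g • j.2) g u'
      have h5 := hκcoc j.1 (ρ g • j.2) u g
      have h3 : g * u' = u * g := by simp only [u']; group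
      have h6 : ρ u = 1 := u.2
      have h7 : ρ u' = 1 := u'.2
      rw [inv_smul_smul, h7, transv_one_right, hβone, h3] at h4
      rw [h6, transv_one_right, hone_β, inv_one, one_smul] at h5
      have h8 := dvd_sub h5 h4
      rw [show ∀ x y z w : ℤ, 0 - (x - y + z) - (0 - (w - y + x)) = w - z from
        fun _ _ _ _ => by ring] at h8
      exact h8
    have h1 := DFunLike.congr_fun (sub_eq_zero.1 hα') ⟨i, ρ g • q⟩
    have h2 : E.symm ⟨i, ρ g • q⟩ = ⟨i, q⟩ := by
      rw [Equiv.symm_apply_eq]; rfl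
    rw [h1]
    simp [α', Finsupp.equivMapDomain_apply, h2]
  let a : B.Orbit → A := fun i => α ⟨i, ((1 : H) : H ⧸ B.stab i)⟩
  have ha : ∀ i (s : B.stab i), A.ρ s (a i) = a i := fun i s => by
    rw [← hαinv]
    congr 2
    have : ((s : H) • ((1 : H) : H ⧸ B.stab i)) = ((s * 1 : H) : H ⧸ B.stab i) := rfl
    rw [this, mul_one, eq_comm, QuotientGroup.eq]
    simp
  have haout : ∀ i (q : H ⧸ B.stab i), A.ρ q.out (a i) = α ⟨i, q⟩ := fun i q => by
    rw [← hαinv]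
    congr 2
    conv_rhs => rw [← q.out_eq']
    have : (q.out • ((1 : H) : H ⧸ B.stab i)) = ((q.out * 1 : H) : H ⧸ B.stab i) := rfl
    rw [this, mul_one]
  -- the correction of `b` by the induced cochains
  let s : Finset B.Orbit := α.support.image Sigma.fst
  choose C hC hCmem using fun i =>
    exists_mem_corCupSubgroup A (B.stab i) (a i) (ha i) (fun x => β i x.1 x.2) (hβcoc i)
  let b' : Gal(S/K) → A := fun g => ∑ i ∈ s, inducedCochain A (B.stab i) (κ i) (a i) g
  have hb' : ∀ g h, (∑ i ∈ s, C i) (ρ g, ρ h) = A.ρ (ρ g) (b' h) - b' (g * h) + b' g :=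
    fun g h => by
    have h1 : (∑ i ∈ s, C i) (ρ g, ρ h) = ∑ i ∈ s, C i (ρ g, ρ h) :=
      map_sum (AddMonoidHom.mk' (fun c : groupCohomology.cocycles₂ A => c (ρ g, ρ h))
        fun _ _ => rfl) C s
    rw [h1, map_sum, ← Finset.sum_sub_distrib, ← Finset.sum_add_distrib]
    refine Finset.sum_congr rfl fun i _ => ?_
    rw [hC]
    exact coboundary_inducedCochain A ρ (B.stab i) (κ i) (fun x => β i x.1 x.2)
      (hA ▸ AddMonoid.exponent_nsmul_eq_zero _) (ha i) (hκcoc i) g h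
  have hb'φ : ∀ u : ρ.ker, b' u = φ u := fun u => by
    rw [hα, Finsupp.sum_of_support_subset α (s := s.sigma fun i => Finset.univ)
      (fun j hj => by simpa [s] using ⟨j.2, by simpa using hj⟩) _ (by simp), Finset.sum_sigma]
    refine Finset.sum_congr rfl fun i _ => Finset.sum_congr rfl fun q _ => ?_
    rw [map_zsmul, haout]
  have hb'mul : ∀ g, ∀ u : ρ.ker, b' (g * u) = b' g + A.ρ (ρ g) (φ u) := fun g u => by
    have h1 : ∀ i, C i (ρ g, ρ u) = 0 := fun i => by
      have h6 : ρ u = 1 := u.2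
      rw [hC]
      refine Finset.sum_eq_zero fun q _ => ?_
      rw [h6, transv_one_right, hβone, zero_smul, map_zero]
    have h2 := hb' g u
    have h3 : (∑ i ∈ s, C i) (ρ g, ρ u) = ∑ i ∈ s, C i (ρ g, ρ u) :=
      map_sum (AddMonoidHom.mk' (fun c : groupCohomology.cocycles₂ A => c (ρ g, ρ u))
        fun _ _ => rfl) C s
    rw [h3, Finset.sum_eq_zero fun i _ => h1 i, hb'φ] at h2
    rw [← sub_eq_zero, ← neg_eq_zero, h2]
    abel
  choose σ hσ using hsurj
  let D : H → A := fun h => b (σ h) - b' (σ h)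
  have hD : ∀ g, D (ρ g) = b g - b' g := fun g => by
    let u : ρ.ker := ⟨g⁻¹ * σ (ρ g), by
      rw [MonoidHom.mem_ker, map_mul, hσ, map_inv, inv_mul_cancel]⟩
    have h1 : σ (ρ g) = g * u := by simp [u]
    simp only [D]
    rw [h1, hbone, hb'mul]
    abel
  have hcC : groupCohomology.H2π A c = groupCohomology.H2π A (∑ i ∈ s, C i) := by
    rw [← sub_eq_zero, ← map_sub, groupCohomology.H2π_eq_zero_iff]
    refine ⟨D, funext fun x => ?_⟩
    obtain ⟨g, hg⟩ : ∃ g, ρ g = x.1 := ⟨_, hσ _⟩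
    obtain ⟨h, hh⟩ : ∃ h, ρ h = x.2 := ⟨_, hσ _⟩
    obtain ⟨_, _⟩ := x
    subst hg hh
    change A.ρ (ρ g) (D (ρ h)) - D (ρ g * ρ h) + D (ρ g) =
      c (ρ g, ρ h) - (∑ i ∈ s, C i) (ρ g, ρ h)
    rw [← map_mul, hD, hD, hD, hb', hcb, map_sub]
    abel
  rw [hcC, map_sum]
  exact sum_mem fun i _ => hCmem i

end Core

/-! ### Factorial rings with a group action -/

section UFD

variable {R : Type u} [CommRing R] {H : Type v} [Group H] [MulSemiringAction H R]

theorem irreducible_smul_iff (h : H) (p : R) : Irreducible (h • p) ↔ Irreducible p :=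
  MulEquiv.irreducible_iff (MulSemiringAction.toRingEquiv H R h)

theorem associated_group_smul {p q : R} (hpq : Associated p q) (h : H) :
    Associated (h • p) (h • q) :=
  hpq.map (MulSemiringAction.toRingHom H R h)

variable (R H) in
/-- Irreducible elements are equivalent if some translate of one under `H` is associated to the
other. -/
def irreducibleSetoid : Setoid {p : R // Irreducible p} where
  r p q := ∃ h : H, Associated (h • p.1) q.1
  iseqv := by
    refine ⟨fun p => ⟨1, by rw [one_smul]⟩, ?_, ?_⟩
    · rintro p q ⟨h, hpq⟩
      refine ⟨h⁻¹, ?_⟩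
      simpa using (associated_group_smul hpq h⁻¹).symm
    · rintro p q r ⟨h, hpq⟩ ⟨g, hqr⟩
      refine ⟨g * h, ?_⟩
      rw [mul_smul]
      exact (associated_group_smul hpq g).trans hqr

variable (H) in
/-- The stabilizer of the class of `p` up to units. -/
def associatedStabilizer (p : R) : Subgroup H where
  carrier := {h | Associated (h • p) p}
  one_mem' := by simp
  mul_mem' {g h} hg hh := by
    change Associated ((g * h) • p) p
    rw [mul_smul]
    exact (associated_group_smul hh g).trans hg
  inv_mem' {g} hg := by
    change Associated (g⁻¹ • p) p
    simpa using (associated_group_smul (Associated.symm hg) g⁻¹)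

/-- The element `q.out • p`, for the chosen representative `p` of an orbit of irreducible elements
and a coset `q` of its stabilizer. Up to units, every irreducible element occurs exactly once. -/
def orbitIrreducible (j : Σ i : Quotient (irreducibleSetoid R H),
    H ⧸ associatedStabilizer H i.out.1) : R :=
  j.2.out • j.1.out.1

theorem irreducible_orbitIrreducible (j : Σ i : Quotient (irreducibleSetoid R H),
    H ⧸ associatedStabilizer H i.out.1) : Irreducible (orbitIrreducible j) :=
  (irreducible_smul_iff _ _).2 j.1.out.2

theorem exists_associated_orbitIrreducible {p : R} (hp : Irreducible p) :
    ∃ j : Σ i : Quotient (irreducibleSetoid R H), H ⧸ associatedStabilizer H i.out.1,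
      Associated (orbitIrreducible j) p := by
  let i : Quotient (irreducibleSetoid R H) := Quotient.mk _ ⟨p, hp⟩
  obtain ⟨h, hh⟩ : ∃ h : H, Associated (h • i.out.1) p :=
    Quotient.exact (s := irreducibleSetoid R H) (Quotient.out_eq i)
  obtain ⟨s, hs⟩ := QuotientGroup.mk_out_eq_mul (associatedStabilizer H i.out.1) h
  refine ⟨⟨i, h⟩, ?_⟩
  change Associated ((h : H ⧸ associatedStabilizer H i.out.1).out • i.out.1) p
  rw [hs, mul_smul]
  exact (associated_group_smul s.2 h).trans hh

theorem orbitIrreducible_injective {j j' : Σ i : Quotient (irreducibleSetoid R H),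
    H ⧸ associatedStabilizer H i.out.1}
    (h : Associated (orbitIrreducible j) (orbitIrreducible j')) : j = j' := by
  obtain ⟨i, q⟩ := j
  obtain ⟨i', q'⟩ := j'
  have h1 : Associated ((q'.out⁻¹ * q.out) • i.out.1) i'.out.1 := by
    have := associated_group_smul h q'.out⁻¹
    simpa [orbitIrreducible, mul_smul] using this
  obtain rfl : i = i' := by
    rw [← i.out_eq, ← i'.out_eq]
    exact Quotient.sound (s := irreducibleSetoid R H) ⟨_, h1⟩
  congr 1
  rw [← q.out_eq', ← q'.out_eq', eq_comm]
  exact QuotientGroup.eq.2 h1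

variable [IsDomain R] [UniqueFactorizationMonoid R]

theorem exists_eq_unit_mul_prod_orbitIrreducible (x : R) (hx : x ≠ 0) :
    ∃ (v : Rˣ) (e : (Σ i : Quotient (irreducibleSetoid R H),
      H ⧸ associatedStabilizer H i.out.1) →₀ ℕ),
      x = v * e.prod fun j k => orbitIrreducible j ^ k := by
  classical
  induction x using UniqueFactorizationMonoid.induction_on_prime with
  | h₁ => exact absurd rfl hx
  | h₂ x hu => exact ⟨hu.unit, 0, by simp⟩
  | h₃ a p ha hp ih =>
    obtain ⟨v, e, rfl⟩ := ih ha
    obtain ⟨j, w, hw⟩ := exists_associated_orbitIrreducible (H := H) hp.irreducible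
    refine ⟨w * v, Finsupp.single j 1 + e, ?_⟩
    rw [Finsupp.prod_add_index' (by simp) (fun _ _ _ => pow_add _ _ _), Finsupp.prod_single_index
      (by simp), ← hw]
    push_cast
    ring

theorem dvd_of_pow_mul_eq_prod_orbitIrreducible {d : ℕ} {a b : R} (ha : a ≠ 0) (hb : b ≠ 0)
    (e : (Σ i : Quotient (irreducibleSetoid R H), H ⧸ associatedStabilizer H i.out.1) →₀ ℕ)
    (h : a ^ d = b ^ d * e.prod fun j k => orbitIrreducible j ^ k) (j) : d ∣ e j := by
  classical
  have hp : Prime (orbitIrreducible j) :=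
    UniqueFactorizationMonoid.irreducible_iff_prime.1 (irreducible_orbitIrreducible j)
  have h1 := congrArg (emultiplicity (orbitIrreducible j)) h
  have h2 : emultiplicity (orbitIrreducible j) (e.prod fun j k => orbitIrreducible j ^ k) =
      (e j : ℕ∞) := by
    rw [Finsupp.prod, Finset.emultiplicity_prod hp]
    have h3 : ∀ i, emultiplicity (orbitIrreducible j) (orbitIrreducible i ^ e i) =
        if j = i then (e i : ℕ∞) else 0 := fun i => by
      split_ifs with hij
      · subst hij
        exact emultiplicity_pow_self hp.ne_zero hp.not_isUnit _
      · rw [emultiplicity_eq_zero]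
        intro hd
        exact hij (orbitIrreducible_injective ((hp.irreducible.associated_of_dvd
          (irreducible_orbitIrreducible i) (hp.dvd_of_dvd_pow hd))))
    simp only [h3]
    rw [Finset.sum_ite_eq]
    split_ifs with hj
    · rfl
    · rw [Finsupp.notMem_support_iff.1 hj]; rfl
  rw [emultiplicity_mul hp, emultiplicity_pow hp, emultiplicity_pow hp, h2,
    (FiniteMultiplicity.of_prime_left hp ha).emultiplicity_eq_multiplicity,
    (FiniteMultiplicity.of_prime_left hp hb).emultiplicity_eq_multiplicity] at h1
  have h4 : d * multiplicity (orbitIrreducible j) a =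
      d * multiplicity (orbitIrreducible j) b + e j := by exact_mod_cast h1
  exact (Nat.dvd_add_right (Dvd.intro _ rfl)).1 (h4 ▸ Dvd.intro _ rfl)

/-- The irreducible elements of a factorial ring with an action of `H`, chosen compatibly with the
action, form a permutation basis of its fraction field, if the units are divisible and fixed by
`H`. -/
theorem nonempty_permutationBasis {L : Type u} [Field L] [Algebra R L] [IsFractionRing R L]
    [MulSemiringAction H L] (hL : ∀ (h : H) (x : R), h • algebraMap R L x = algebraMap R L (h • x))
    (hfix : ∀ (v : Rˣ) (h : H), h • (v : R) = v)
    (hdiv : ∀ d > 0, ∀ v : Rˣ, ∃ w : Rˣ, w ^ d = v)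
    {m : ℕ} (hm : 0 < m) (hH : ∀ h : H, h ^ m = 1) {ω : R} (hω : IsPrimitiveRoot ω m) :
    Nonempty (PermutationBasis.{u, v, u} H L (algebraMap R L ω)) := by
  classical
  have hinj := IsFractionRing.injective R L
  have hX : ∀ (i : Quotient (irreducibleSetoid R H)) (s : associatedStabilizer H i.out.1),
      ∃ k : ℕ, i.out.1 = ω ^ k * (s : H) • i.out.1 := fun i s => by
    obtain ⟨v, hv⟩ := s.2
    have h1 : ∀ (p : R) (g : H), g • p * v = p → ∀ k : ℕ, p = g ^ k • p * (v : R) ^ k :=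
        fun p g hp k => by
      induction k with
      | zero => simp
      | succ k ih =>
        have h2 := congrArg (g ^ k • ·) hp
        simp only [smul_mul', hfix, smul_smul, ← pow_succ] at h2
        rw [pow_succ' (v : R), ← mul_assoc, h2, ← ih]
    have h2 := h1 _ _ hv m
    rw [hH, one_smul] at h2
    have h3 : (v : R) ^ m = 1 := (mul_right_eq_self₀.1 h2.symm).resolve_right i.out.2.ne_zero
    have : NeZero m := ⟨hm.ne'⟩
    obtain ⟨k, -, hk⟩ := hω.eq_pow_of_pow_eq_one h3
    exact ⟨k, by rw [hk, mul_comm]; exact hv.symm⟩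
  choose X hX using hX
  have hP : ∀ j : Σ i : Quotient (irreducibleSetoid R H), H ⧸ associatedStabilizer H i.out.1,
      j.2.out • algebraMap R L j.1.out.1 = algebraMap R L (orbitIrreducible j) := fun j => hL _ _
  refine ⟨{
    Orbit := Quotient (irreducibleSetoid R H)
    stab := fun i => associatedStabilizer H i.out.1
    p := fun i => algebraMap R L i.out.1
    p_ne_zero := fun i => by simpa using i.out.2.ne_zero
    X := fun i s => if s = 1 then 0 else X i s
    X_one := fun i => if_pos rfl
    p_eq := fun i s => ?_
    exists_eq := fun d hd x hx => ?_
    dvd_of_pow_eq := fun d hd y e hy j => ?_ }⟩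
  · split_ifs with hs
    · simp [hs]
    · rw [hL, zpow_natCast, ← map_pow, ← map_mul, ← hX]
  · obtain ⟨a, b, hb, rfl⟩ := IsFractionRing.div_surjective (A := R) x
    have hb0 := nonZeroDivisors.ne_zero hb
    have ha0 : a ≠ 0 := by rintro rfl; simp at hx
    obtain ⟨v, e, he⟩ := exists_eq_unit_mul_prod_orbitIrreducible (H := H) (a * b ^ (d - 1))
      (mul_ne_zero ha0 (pow_ne_zero _ hb0))
    obtain ⟨w, rfl⟩ := hdiv d hd v
    have hbL : algebraMap R L b ≠ 0 := by simpa using hb0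
    refine ⟨algebraMap R L w / algebraMap R L b, div_ne_zero (by simp) hbL, e, ?_⟩
    simp only [hP]
    have h1 : (e.prod fun j k => algebraMap R L (orbitIrreducible j) ^ k) =
        algebraMap R L (e.prod fun j k => orbitIrreducible j ^ k) := by
      simp [Finsupp.prod]
    have h2 := congrArg (algebraMap R L) he
    rw [h1, div_pow, div_mul_eq_mul_div, div_eq_div_iff hbL (pow_ne_zero _ hbL)]
    rw [map_mul, map_mul, map_pow, Units.val_pow_eq_pow_val, map_pow] at h2
    rw [← h2, mul_assoc, ← pow_succ, Nat.sub_add_cancel hd]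
  · obtain ⟨a, b, hb, rfl⟩ := IsFractionRing.div_surjective (A := R) y
    have hb0 := nonZeroDivisors.ne_zero hb
    have hbL : algebraMap R L b ≠ 0 := by simpa using hb0
    simp only [hP] at hy
    have h1 : (e.prod fun j k => algebraMap R L (orbitIrreducible j) ^ k) =
        algebraMap R L (e.prod fun j k => orbitIrreducible j ^ k) := by
      simp [Finsupp.prod]
    have h0 : (e.prod fun j k => orbitIrreducible j ^ k) ≠ 0 :=
      Finsupp.prod_ne_zero_iff.2 fun j _ => pow_ne_zero _ (irreducible_orbitIrreducible j).ne_zero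
    have h2 : a ^ d = b ^ d * e.prod fun j k => orbitIrreducible j ^ k := by
      apply hinj
      rw [h1, div_pow, div_eq_iff (pow_ne_zero _ hbL)] at hy
      rw [map_pow, hy, map_mul, map_pow, mul_comm]
    refine dvd_of_pow_mul_eq_prod_orbitIrreducible ?_ hb0 e h2 j
    rintro rfl
    rw [zero_pow hd.ne'] at h2
    exact mul_ne_zero (pow_ne_zero _ hb0) h0 h2.symm

end UFD

/-! ### The function field of the regular representation -/

section GenericExtension

/-- Restriction of automorphisms along an embedding of normal extensions. It is stated for general
fields because, over a fixed field of `L`, an algebra structure of `S` over `L` would induce a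
second action of the ground field on `S`. -/
theorem exists_restrict_algHom {K L S : Type*} [Field K] [Field L] [Field S] [Algebra K L]
    [Algebra K S] [Normal K L] [Normal K S] (f : L →ₐ[K] S) :
    ∃ r : Gal(S/K) →* Gal(L/K), Function.Surjective r ∧ ∀ g l, f (r g l) = g (f l) := by
  let _ : Algebra L S := f.toRingHom.toAlgebra
  have : IsScalarTower K L S := IsScalarTower.of_algebraMap_eq fun a => (f.commutes a).symm
  exact ⟨AlgEquiv.restrictNormalHom L, AlgEquiv.restrictNormalHom_surjective S,
    fun g l => AlgEquiv.restrictNormal_commutes g L l⟩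

/-- For a faithful action of a finite group `H` on a field `L`, the absolute Galois group of the
fixed field of `H` maps onto `H`, with kernel the absolute Galois group of `L`. -/
theorem exists_absGal_fixedField_hom {H : Type} [Group H] [Finite H] {L : Type u} [Field L]
    [MulSemiringAction H L] (x₀ : L) (hx₀ : Function.Injective fun h : H => h • x₀) :
    ∃ (ι : L →+* SeparableClosure (FixedPoints.subfield H L))
      (ρ : AbsGal (FixedPoints.subfield H L) →* H),
      (∀ a : FixedPoints.subfield H L, ι a = algebraMap _ _ a) ∧
      (∀ g l, ι (ρ g • l) = g (ι l)) ∧ Function.Surjective ρ ∧ IsLocallyConstant ρ ∧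
      ∀ x, (∀ g, ρ g = 1 → g x = x) → ∃ l, ι l = x := by
  have : FaithfulSMul H L := ⟨fun h => hx₀ (h x₀)⟩
  let K := FixedPoints.subfield H L
  let S := SeparableClosure K
  let f : L →ₐ[K] S := IsSepClosed.lift
  obtain ⟨r, hr, hrf⟩ := exists_restrict_algHom f
  let e := FixedPoints.toAlgAutMulEquiv H L
  let ρ : AbsGal K →* H := e.symm.toMonoidHom.comp r
  have hι : ∀ (g : AbsGal K) (l : L), f (ρ g • l) = g (f l) := fun g l => by
    rw [← hrf]
    exact congrArg f (DFunLike.congr_fun (e.apply_symm_apply (r g)) l)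
  have hinj : Function.Injective fun h : H => f (h • x₀) := f.injective.comp hx₀
  refine ⟨f, ρ, f.commutes, hι, e.symm.surjective.comp hr,
    IsLocallyConstant.desc _ (fun h : H => f (h • x₀)) ?_ hinj, fun x hx => ?_⟩
  · have h1 : (fun h : H => f (h • x₀)) ∘ ρ = fun g : AbsGal K => g (f x₀) :=
      funext fun g => hι g x₀
    rw [h1]
    exact isLocallyConstant_apply _
  · have h1 : x ∈ f.fieldRange := by
      rw [← InfiniteGalois.fixedField_fixingSubgroup f.fieldRange,
        IntermediateField.mem_fixedField_iff]
      refine fun g hg => hx g (hinj ?_)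
      simp only
      rw [hι, one_smul]
      exact hg ⟨f x₀, x₀, rfl⟩
    exact h1

/-- The action of `H` on the polynomial ring in variables indexed by `H`, by permutation of the
variables. -/
abbrev permuteVariables (k H : Type*) [CommSemiring k] [Group H] :
    MulSemiringAction H (MvPolynomial H k) :=
  MulSemiringAction.compHom (MvPolynomial H k)
    ({ toFun := fun h => MvPolynomial.renameEquiv k (Equiv.mulLeft h)
       map_one' := by ext; simp
       map_mul' := fun g h => by ext; simp [mul_assoc] } :
      H →* (MvPolynomial H k ≃ₐ[k] MvPolynomial H k))

/-- Over the fixed field of the function field of the regular representation of `H` over an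
algebraically closed field, the constants contribute nothing because they are divisible, and the
divisors form a permutation module. -/
theorem negligibleSubgroup_le_corCupSubgroup {H : Type} [Group H] [Finite H] (A : Rep.{0} ℤ H)
    [Finite A] (F : Type u) [Field F]
    (hF : ∃ ζ : F, IsPrimitiveRoot ζ (AddMonoid.exponent A * Monoid.exponent H)) :
    negligibleSubgroup F A ≤ corCupSubgroup A := by
  intro x hx
  obtain ⟨c, rfl⟩ := surjective_H2π A x
  obtain ⟨ζ, hζ⟩ := hF
  set n := AddMonoid.exponent A with hn
  set m := Monoid.exponent H with hm
  have hn0 : 0 < n := Nat.pos_of_ne_zero AddMonoid.exponent_ne_zero_of_finite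
  have hm0 : 0 < m := Nat.pos_of_ne_zero Monoid.exponent_ne_zero_of_finite
  have hnm : 0 < n * m := Nat.mul_pos hn0 hm0
  let k := AlgebraicClosure F
  let R := MvPolynomial H k
  let L := FractionRing R
  let _ : MulSemiringAction H R := permuteVariables k H
  let _ : MulSemiringAction H L := IsFractionRing.mulSemiringAction H R L
  have hsmul : ∀ (h : H) (r : R), h • r = MvPolynomial.rename (h * ·) r := fun h r => rfl
  have hL : ∀ (h : H) (r : R), h • algebraMap R L r = algebraMap R L (h • r) := fun h r =>
    IsFractionRing.ringEquivOfRingEquiv_algebraMap _ r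
  have hC : ∀ (h : H) (a : k), h • (MvPolynomial.C a : R) = MvPolynomial.C a := fun h a => by
    rw [hsmul, MvPolynomial.rename_C]
  have hunit : ∀ v : Rˣ, ∃ a : k, a ≠ 0 ∧ (v : R) = MvPolynomial.C a := fun v => by
    obtain ⟨a, ha, hv⟩ := MvPolynomial.isUnit_iff_eq_C_of_isReduced.1 v.isUnit
    exact ⟨a, ha.ne_zero, hv⟩
  have hinjR : Function.Injective (algebraMap R L) := IsFractionRing.injective R L
  -- the root of unity in the fixed field
  let K := FixedPoints.subfield H L
  let toL : F →+* L := (algebraMap R L).comp (MvPolynomial.C.comp (algebraMap F k))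
  let toK : F →+* K := toL.codRestrict K fun a h => by
    change h • algebraMap R L (MvPolynomial.C (algebraMap F k a)) = _
    rw [hL, hC]
    rfl
  let _ : Algebra F K := toK.toAlgebra
  have hζK := hζ.map_of_injective toK.injective
  have : NeZero (n * m) := ⟨hnm.ne'⟩
  obtain ⟨ξ, hξ, hξ'⟩ : ∃ ξ : Kˣ, IsPrimitiveRoot ξ (n * m) ∧ (ξ : K) = toK ζ :=
    ⟨hζK.toRootsOfUnity, IsPrimitiveRoot.coe_units_iff.1 hζK, rfl⟩
  let ω : R := MvPolynomial.C (algebraMap F k ζ) ^ n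
  have hω : IsPrimitiveRoot ω m := by
    refine IsPrimitiveRoot.pow hnm ?_ rfl
    exact hζ.map_of_injective (f := MvPolynomial.C.comp (algebraMap F k))
      ((MvPolynomial.C_injective H k).comp (algebraMap F k).injective)
  obtain ⟨B⟩ := nonempty_permutationBasis (L := L) hL
    (fun v h => by obtain ⟨a, -, ha⟩ := hunit v; rw [ha, hC])
    (fun d hd v => by
      obtain ⟨a, ha0, ha⟩ := hunit v
      obtain ⟨b, hb⟩ := IsAlgClosed.exists_pow_nat_eq a hd
      have hb0 : b ≠ 0 := by rintro rfl; rw [zero_pow hd.ne'] at hb; exact ha0 hb.symm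
      refine ⟨Units.map (MvPolynomial.C : k →+* R).toMonoidHom (Units.mk0 b hb0), Units.ext ?_⟩
      rw [ha, ← hb, map_pow]
      rfl)
    hm0 (fun h => Monoid.pow_exponent_eq_one h) hω
  obtain ⟨ι, ρ, hιK, hι, hsurj, hρ, hfix⟩ := exists_absGal_fixedField_hom (H := H)
    (algebraMap R L (MvPolynomial.X 1)) fun g h hgh => by
      simp only [hL, hsmul, MvPolynomial.rename_X, mul_one] at hgh
      exact MvPolynomial.X_injective (hinjR hgh)
  obtain ⟨b, hb, hcb⟩ := (pullback_H2π_eq_zero_iff A ρ hρ c).1 (hx K ρ hρ)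
  refine H2π_mem_corCupSubgroup_of_permutationBasis A ρ hρ hsurj ι hι hfix hn.symm hm0 hξ ?_ B c b
    hb hcb
  rw [← hιK, Units.val_pow_eq_pow_val, hξ']
  exact congrArg ι (map_pow (algebraMap R L) _ n)

end GenericExtension

theorem negligibleSubgroup_eq_corCupSubgroup {H : Type} [Group H] [Finite H] (A : Rep.{0} ℤ H)
    [Finite A] (F : Type u) [Field F]
    (hF : ∃ ζ : F, IsPrimitiveRoot ζ (AddMonoid.exponent A * Monoid.exponent H)) :
    negligibleSubgroup F A = corCupSubgroup A :=
  le_antisymm (negligibleSubgroup_le_corCupSubgroup A F hF)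
    (corCupSubgroup_le_negligibleSubgroup A F hF)

end NegligibleClasses

end

theorem mainTheorem1 {H : Type} [Group H] [Finite H] (A : Rep.{0} ℤ H) [Finite A]
    (F : Type u) [Field F]
    (hF : ∃ ζ : F, IsPrimitiveRoot ζ (AddMonoid.exponent A * Monoid.exponent H)) :
    NegligibleClasses.negligibleSubgroup F A = NegligibleClasses.corCupSubgroup A ∧
      ∀ (F' : Type v) [Field F'],
        (∃ ζ : F', IsPrimitiveRoot ζ (AddMonoid.exponent A * Monoid.exponent H)) →
          NegligibleClasses.negligibleSubgroup F' A =
            NegligibleClasses.negligibleSubgroup F A :=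
  ⟨NegligibleClasses.negligibleSubgroup_eq_corCupSubgroup A F hF, fun F' _ hF' =>
    (NegligibleClasses.negligibleSubgroup_eq_corCupSubgroup A F' hF').trans
      (NegligibleClasses.negligibleSubgroup_eq_corCupSubgroup A F hF).symm⟩
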